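/- Let $\Omega\subset\mathbb{R}^n$ be open, bounded and simply connected (in particular non-empty and connected), and let $G,\tilde G$ be two smooth fields of symmetric positive definite $n\times n$ matrices on $\Omega$. Let $\tilde\Gamma_{ij}^m=\frac12\tilde G^{mk}(\partial_j\tilde G_{ki}+\partial_i\tilde G_{kj}-\partial_k\tilde G_{ij})$ be the Christoffel symbols of $\tilde G$, where upper indices denote the inverse matrix and repeated indices are summed. For $\xi:\Omega\to\mathbb{R}^n$ and a matrix field $w:\Omega\to\mathbb{R}^{n\times n}$ with columns $w_1,\dots,w_n$ and inverse $W$ (where $W_m^t$ is the entry of $w^{-1}$ in row $t$ and column $m$), consider the problem $$(\nabla\xi)^T G\,\nabla\xi=\tilde G\quad\text{a.e. in }\Omega \tag{P}$$ and the system $$\tilde G_{ij}=w_i^t\,G_{st}\,w_j^s, \tag{a}$$ $$w_i^t=\partial_i\xi^t, \tag{b}$$ $$\partial_j w_i^s=w_m^s\tilde\Gamma_{ij}^m-\tfrac12 G^{sm}\Big(w_i^p\,\partial_jG_{mp}+w_j^p\,\partial_iG_{mp}-w_j^pw_i^q\,\partial_tG_{pq}\,W_m^t\Big). \tag{c}$$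 A bilipschitz map below means a map $\xi:\Omega\to U:=\xi(\Omega)$ onto an open set which is Lipschitz together with its inverse. A solution of (P) is a bilipschitz $\xi\in W^{2,2}(\Omega,\mathbb{R}^n)$ satisfying (P). A solution of (a)–(c) is a pair $(\xi,w)$ with $\xi$ bilipschitz and $w\in W^{1,2}(\Omega,\mathbb{R}^{n\times n})$, where (a), (b) hold a.e. in $\Omega$ and (c) holds in the sense of weak derivatives. A bounded solution of (c) is a field $w\in L^\infty(\Omega,\mathbb{R}^{n\times n})$, invertible a.e. with $W\in L^\infty(\Omega,\mathbb{R}^{n\times n})$, satisfying (c) in the sense of distributions. Then: (i) (P) has a solution if and only if (a)–(c) has a solution. More precisely, a map $\xi$ is a solution of (P) if and only if there is $w$ such that $(\xi,w)$ is a solution of (a)–(c). (ii) If $(\xi,w)$ is a solution of (a)–(c), then $w$ is a bounded solution of (c). Conversely, let $w$ be a bounded solution of (c). Then there exists a smooth $\xi:\Omega\to\mathbb{R}^n$ with $\nabla\xi=w$ a.e. in $\Omega$. Moreover, every such $\xi$ has the following properties. - $\xi$ is locally invertible with smooth inverse: each point of $\Omega$ has an open neighbourhood $V\subset\Omega$ on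 which $\xi$ is injective, and for every open $V\subset\Omega$ on which $\xi$ is injective, $\xi(V)$ is open and the inverse $\zeta:\xi(V)\to V$ of $\xi|_V$ is smooth. - For every such $V$ and $\zeta$, the metrics $\mathcal{G}=G\circ\zeta$ and $\tilde{\mathcal{G}}=(\nabla\zeta)^T(\tilde G\circ\zeta)\,\nabla\zeta$ have the same Christoffel symbols on $\xi(V)$. - If $\xi$ is injective on all of $\Omega$ and $\tilde G(x_0)=(\nabla\xi)^TG\,\nabla\xi\,(x_0)$ for some $x_0\in\Omega$, then $\tilde G=(\nabla\xi)^TG\,\nabla\xi$ everywhere in $\Omega$. -/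

import Mathlib

open MeasureTheory
open scoped ContDiff Matrix

noncomputable section

namespace InverseDesign

/-- The Euclidean space `ℝⁿ`. -/
abbrev Eu (n : ℕ) : Type := EuclideanSpace ℝ (Fin n)

/-- Matrix fields on `ℝⁿ`; only their values on the domain `Ω` are used. -/
abbrev MatField (n : ℕ) : Type := Eu n → Matrix (Fin n) (Fin n) ℝ

variable {n : ℕ}

/-- The `i`-th standard basis vector. -/
def basisVec (i : Fin n) : Eu n := EuclideanSpace.single i (1 : ℝ)

/-- The classical partial derivative `∂ᵢ f (x)`. -/
def pd (i : Fin n) (f : Eu n → ℝ) (x : Eu n) : ℝ := fderiv ℝ f x (basisVec i)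

/-- The gradient matrix `∇ξ (x)`, with entry `∂ᵢ ξᵗ (x)` in row `t` and column `i`. -/
def jac (ξ : Eu n → Eu n) : MatField n :=
  fun x => Matrix.of fun t i => (fderiv ℝ ξ x (basisVec i)) t

/-- A smooth Riemannian metric on `Ω`: a smooth field of symmetric positive definite matrices. -/
structure IsSmoothMetricOn (Ω : Set (Eu n)) (g : MatField n) : Prop where
  smooth : ∀ i j, ContDiffOn ℝ ∞ (fun x => g x i j) Ω
  posDef : ∀ x ∈ Ω, (g x).PosDef

/-- Christoffel symbol of the second kind
`Γⁱₖₗ = ½ gⁱᵐ (∂ₗ gₘₖ + ∂ₖ gₘₗ - ∂ₘ gₖₗ)` of the metric `g` at `x`. -/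
def christoffel (g : MatField n) (i k l : Fin n) (x : Eu n) : ℝ :=
  (1 / 2) * ∑ m, (g x)⁻¹ i m *
    (pd l (fun y => g y m k) x + pd k (fun y => g y m l) x - pd m (fun y => g y k l) x)

/-- `g` is the weak (distributional) `i`-th partial derivative of `f` in the open set `Ω`. -/
def HasWeakPartial (Ω : Set (Eu n)) (i : Fin n) (f g : Eu n → ℝ) : Prop :=
  LocallyIntegrableOn f Ω volume ∧ LocallyIntegrableOn g Ω volume ∧
    ∀ φ : Eu n → ℝ, ContDiff ℝ ∞ φ → HasCompactSupport φ → tsupport φ ⊆ Ω →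
      ∫ x in Ω, f x * pd i φ x = - ∫ x in Ω, g x * φ x

/-- The Sobolev space `W^{k,2}(Ω)` of real-valued functions. -/
def MemSobolevTwo (Ω : Set (Eu n)) : ℕ → (Eu n → ℝ) → Prop
  | 0, f => MemLp f 2 (volume.restrict Ω)
  | k + 1, f => MemLp f 2 (volume.restrict Ω) ∧
      ∀ i, ∃ g : Eu n → ℝ, HasWeakPartial Ω i f g ∧ MemSobolevTwo Ω k g

/-- `ξ` is a bilipschitz map of `Ω` onto the open set `U = ξ(Ω)`. -/
def IsBilipschitzOn (Ω : Set (Eu n)) (ξ : Eu n → Eu n) : Prop :=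
  IsOpen (ξ '' Ω) ∧ ∃ K : NNReal, LipschitzOnWith K ξ Ω ∧ AntilipschitzWith K (Ω.domRestrict ξ)

/-- `ξ` is a bilipschitz `W^{2,2}` solution of `(∇ξ)ᵀ G ∇ξ = G̃` in `Ω`. A Lipschitz map is
differentiable almost everywhere, its classical gradient being its weak gradient. -/
structure IsDesignSolution (Ω : Set (Eu n)) (G Gt : MatField n) (ξ : Eu n → Eu n) : Prop where
  bilipschitz : IsBilipschitzOn Ω ξ
  sobolev : ∀ t, MemSobolevTwo Ω 2 (fun x => ξ x t)
  eqn : ∀ᵐ x ∂(volume.restrict Ω), Gt x = (jac ξ x)ᵀ * G x * jac ξ x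

/-- The right-hand side
`w_mˢ Γ̃ᵐᵢⱼ - ½ Gˢᵐ (wᵢᵖ ∂ⱼ Gₘₚ + wⱼᵖ ∂ᵢ Gₘₚ - wⱼᵖ wᵢ^q ∂ₜ G_pq Wₘᵗ)` of the total differential
system, where `wᵢˢ = w s i` (the vector `wᵢ` is the `i`-th column of `w`) and
`Wₘᵗ = (w⁻¹) t m`. -/
def totalRHS (G Gt w : MatField n) (s i j : Fin n) (x : Eu n) : ℝ :=
  (∑ m, w x s m * christoffel Gt m i j x)
    - (1 / 2) * ∑ m, (G x)⁻¹ s m *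
        ((∑ p, w x p i * pd j (fun y => G y m p) x)
          + (∑ p, w x p j * pd i (fun y => G y m p) x)
          - ∑ p, ∑ q, ∑ t, w x p j * w x q i * pd t (fun y => G y p q) x * (w x)⁻¹ t m)

/-- The total differential system `∂ⱼ wᵢˢ = totalRHS` holds in `Ω` in the sense of
distributions. -/
def SolvesTotal (Ω : Set (Eu n)) (G Gt w : MatField n) : Prop :=
  ∀ s i j, HasWeakPartial Ω j (fun x => w x s i) (totalRHS G Gt w s i j)

/-- `(ξ, w)` solves the algebraic-differential system, with `ξ` bilipschitz and
`w ∈ W^{1,2}(Ω)`. -/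
structure IsSystemSolution (Ω : Set (Eu n)) (G Gt : MatField n) (ξ : Eu n → Eu n)
    (w : MatField n) : Prop where
  bilipschitz : IsBilipschitzOn Ω ξ
  sobolev : ∀ s i, MemSobolevTwo Ω 1 (fun x => w x s i)
  algebraic : ∀ᵐ x ∂(volume.restrict Ω), Gt x = (w x)ᵀ * G x * w x
  gradient : ∀ᵐ x ∂(volume.restrict Ω), w x = jac ξ x
  total : SolvesTotal Ω G Gt w

/-- `w` is an `L^∞` distributional solution of the total differential system whose inverse matrix
field is well defined and belongs to `L^∞`. -/
structure IsBoundedTotalSolution (Ω : Set (Eu n)) (G Gt w : MatField n) : Prop where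
  bounded : ∀ s i, MemLp (fun x => w x s i) ⊤ (volume.restrict Ω)
  invertible : ∀ᵐ x ∂(volume.restrict Ω), IsUnit (w x)
  inv_bounded : ∀ t m, MemLp (fun x => (w x)⁻¹ t m) ⊤ (volume.restrict Ω)
  total : SolvesTotal Ω G Gt w

/-- `ξ` is smooth in `Ω` and `∇ξ = w` almost everywhere in `Ω`. -/
def IsSmoothPotential (Ω : Set (Eu n)) (w : MatField n) (ξ : Eu n → Eu n) : Prop :=
  ContDiffOn ℝ ∞ ξ Ω ∧ ∀ᵐ x ∂(volume.restrict Ω), w x = jac ξ x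

/-- The metric `𝒢 = G ∘ ζ`. -/
def transported (G : MatField n) (ζ : Eu n → Eu n) : MatField n :=
  fun y => G (ζ y)

/-- The metric `𝒢̃ = (∇ζ)ᵀ (G̃ ∘ ζ) ∇ζ`. -/
def pulledBack (Gt : MatField n) (ζ : Eu n → Eu n) : MatField n :=
  fun y => (jac ζ y)ᵀ * Gt (ζ y) * jac ζ y

end InverseDesign

end

open InverseDesign

noncomputable section

namespace InverseDesign

open Filter Topology

variable {n : ℕ} {Ω : Set (Eu n)} {i : Fin n} {f f₁ f₂ g g₁ g₂ u φ : Eu n → ℝ}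

/-! Part (i) is the computation that produces Christoffel symbols, done weakly. A bilipschitz `ξ`
has bounded gradient `w = ∇ξ` with bounded inverse, so `G̃ = wᵀ G w` may be differentiated by a weak
product rule for bounded functions (`HasWeakPartial.mul`). Since `∂ⱼwᵢ = ∂ᵢwⱼ`, the combination
`∂ⱼG̃ₖᵢ + ∂ᵢG̃ₖⱼ - ∂ₖG̃ᵢⱼ` contains `∂ⱼwᵢ` only through `2 wₖ · G ∂ⱼwᵢ`, and solving for it gives
(c) (`eq_total_of_pull`). Conversely, the classical gradient of a Lipschitz map is its weak
gradient, so `w ∈ W^{1,2}` gives `ξ ∈ W^{2,2}`.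

For part (ii), the right side of (c) is locally bounded when `w` and `W` are, so `w` has a
continuous representative. Its determinant cannot vanish because `det W` is bounded. The right side
of (c) is then continuous, `w` is `C¹`, and bootstrapping makes it smooth
(`IsBoundedTotalSolution.exists_classical`). The right side is symmetric in `i, j`, so the rows of
`w` are closed one-forms. They have primitives locally by the Poincaré lemma, and globally because
the covering space of germs of primitives has a section over a simply connected base
(`exists_primitive_of_isSimplyConnected`). Local inverses come from the inverse function theorem.

For the Christoffel symbols, the metric `𝒢̃` pulls back under `ξ` to `G̃`, so the computation of
part (i) yields (c) with `𝒢̃ ∘ ξ` in place of `G`. Comparison with (c) itself shows that the two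
correction terms agree. Each of them is the pullback by `w` of the Christoffel symbols on the image
(`corr_eq_chr`), and the invertible `w` cancels.

For the propagation, (c) makes the defect `D = G̃ - wᵀ G w` satisfy the linear system `∂ₖDᵢⱼ = Γ̃ᵐᵢₖ
Dₘⱼ + Γ̃ᵐⱼₖ Dᵢₘ`. Grönwall's inequality along segments and connectedness then spread a zero of `D`
to all of `Ω`. -/

theorem two_le_infty : (2 : ℕ∞ω) ≤ ∞ := 
  WithTop.coe_le_coe.2 (le_top : (2 : ℕ∞) ≤ ⊤)

/-! ### Partial derivatives and test functions -/

theorem pd_mul {x : Eu n} (hf : DifferentiableAt ℝ f x) (hg : DifferentiableAt ℝ g x) :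
    pd i (fun y => f y * g y) x = f x * pd i g x + pd i f x * g x := by
  simp only [pd]
  rw [fderiv_fun_mul hf hg]
  simp [mul_comm]

theorem pd_congr {x : Eu n} (h : f =ᶠ[𝓝 x] g) : pd i f x = pd i g x := by
  simp only [pd, h.fderiv_eq]

theorem contDiffOn_pd (hΩ : IsOpen Ω) {k m : ℕ∞ω} (hf : ContDiffOn ℝ m f Ω) (h : k + 1 ≤ m) :
    ContDiffOn ℝ k (pd i f) Ω :=
  (hf.fderiv_of_isOpen hΩ h).clm_apply contDiffOn_const

theorem contDiff_pd (hf : ContDiff ℝ ∞ f) : ContDiff ℝ ∞ (pd i f) :=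
  (hf.fderiv_right (m := ∞) (by simp)).clm_apply contDiff_const

theorem tsupport_pd_subset : tsupport (pd i f) ⊆ tsupport f :=
  (closure_mono fun x hx => by
    contrapose! hx
    simp only [Function.mem_support, not_not] at hx ⊢
    simp [pd, hx]).trans (tsupport_fderiv_subset ℝ)

theorem hasCompactSupport_pd (hf : HasCompactSupport f) : HasCompactSupport (pd i f) :=
  hf.of_isClosed_subset (isClosed_tsupport _) tsupport_pd_subset

/-- `φ` is a test function on `Ω`. -/
structure IsTest (Ω : Set (Eu n)) (φ : Eu n → ℝ) : Prop where
  contDiff : ContDiff ℝ ∞ φ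
  compact : HasCompactSupport φ
  subset : tsupport φ ⊆ Ω

theorem IsTest.pd (h : IsTest Ω φ) : IsTest Ω (pd i φ) :=
  ⟨contDiff_pd h.contDiff, hasCompactSupport_pd h.compact, tsupport_pd_subset.trans h.subset⟩

/-- Smoothness of `u` on `Ω` alone suffices, since the product vanishes near every point off the
support of `φ`. -/
theorem IsTest.mul_left (hΩ : IsOpen Ω) (hu : ContDiffOn ℝ ∞ u Ω) (h : IsTest Ω φ) :
    IsTest Ω (fun x => u x * φ x) where
  contDiff := by
    rw [contDiff_iff_contDiffAt]
    intro x
    by_cases hx : x ∈ tsupport φ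
    · exact (hu.contDiffAt (hΩ.mem_nhds (h.subset hx))).mul h.contDiff.contDiffAt
    · refine (contDiffAt_const (c := (0 : ℝ))).congr_of_eventuallyEq ?_
      filter_upwards [notMem_tsupport_iff_eventuallyEq.1 hx] with y hy
      simp [hy]
  compact := h.compact.mul_left
  subset := (tsupport_mul_subset_right).trans h.subset

theorem IsTest.eq_zero (h : IsTest Ω φ) {x : Eu n} (hx : x ∉ Ω) : φ x = 0 :=
  image_eq_zero_of_notMem_tsupport fun hx' => hx (h.subset hx')

theorem IsTest.integrable_mul (h : IsTest Ω φ) (hf : LocallyIntegrableOn f Ω volume) :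
    Integrable (fun x => f x * φ x) volume := by
  have h1 : IntegrableOn (fun x => f x * φ x) (tsupport φ) volume :=
    (hf.integrableOn_compact_subset h.subset h.compact).mul_continuousOn
      h.contDiff.continuous.continuousOn h.compact
  rwa [integrableOn_iff_integrable_of_support_subset] at h1
  intro x hx
  by_contra hx'
  exact hx (by simp [image_eq_zero_of_notMem_tsupport hx'])

theorem IsTest.setIntegral_mul (h : IsTest Ω φ) (f : Eu n → ℝ) :
    ∫ x in Ω, f x * φ x = ∫ x, f x * φ x :=
  setIntegral_eq_integral_of_forall_compl_eq_zero fun x hx => by simp [h.eq_zero hx]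

/-! ### Calculus of weak partial derivatives -/

theorem HasWeakPartial.integral_eq (h : HasWeakPartial Ω i f g) (hφ : IsTest Ω φ) :
    ∫ x, f x * InverseDesign.pd i φ x = - ∫ x, g x * φ x := by
  rw [← hφ.setIntegral_mul, ← hφ.pd.setIntegral_mul]
  exact h.2.2 φ hφ.contDiff hφ.compact hφ.subset

theorem hasWeakPartial_of_integral_eq (hf : LocallyIntegrableOn f Ω volume)
    (hg : LocallyIntegrableOn g Ω volume)
    (h : ∀ φ, IsTest Ω φ → ∫ x, f x * pd i φ x = - ∫ x, g x * φ x) : HasWeakPartial Ω i f g := by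
  refine ⟨hf, hg, fun φ h1 h2 h3 => ?_⟩
  have hφ : IsTest Ω φ := ⟨h1, h2, h3⟩
  rw [hφ.setIntegral_mul, hφ.pd.setIntegral_mul]
  exact h φ hφ

theorem LocallyIntegrableOn.congr_ae (hΩ : IsOpen Ω) (hf : LocallyIntegrableOn f Ω volume)
    (h : f =ᵐ[volume.restrict Ω] g) : LocallyIntegrableOn g Ω volume := by
  rw [locallyIntegrableOn_iff hΩ.isLocallyClosed] at hf ⊢
  exact fun K hK hKc => (hf K hK hKc).congr_fun_ae (ae_restrict_of_ae_restrict_of_subset hK h)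

theorem HasWeakPartial.congr (hΩ : IsOpen Ω) (h : HasWeakPartial Ω i f g)
    (hf : f =ᵐ[volume.restrict Ω] f₁) (hg : g =ᵐ[volume.restrict Ω] g₁) :
    HasWeakPartial Ω i f₁ g₁ := by
  refine ⟨LocallyIntegrableOn.congr_ae hΩ h.1 hf, LocallyIntegrableOn.congr_ae hΩ h.2.1 hg,
    fun φ h1 h2 h3 => ?_⟩
  have e1 : ∫ x in Ω, f₁ x * InverseDesign.pd i φ x = ∫ x in Ω, f x * InverseDesign.pd i φ x :=
    integral_congr_ae (hf.mono fun x hx => by simp [hx])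
  have e2 : ∫ x in Ω, g₁ x * φ x = ∫ x in Ω, g x * φ x :=
    integral_congr_ae (hg.mono fun x hx => by simp [hx])
  rw [e1, e2]
  exact h.2.2 φ h1 h2 h3

theorem ae_eq_of_integral_test (hΩ : IsOpen Ω) (hf : LocallyIntegrableOn f Ω volume)
    (hg : LocallyIntegrableOn g Ω volume)
    (h : ∀ φ, IsTest Ω φ → ∫ x, f x * φ x = ∫ x, g x * φ x) :
    f =ᵐ[volume.restrict Ω] g := by
  rw [Filter.EventuallyEq, ae_restrict_iff' hΩ.measurableSet]
  have := hΩ.ae_eq_zero_of_integral_contDiff_smul_eq_zero (hf.sub hg) (fun φ h1 h2 h3 => by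
    have hφ : IsTest Ω φ := ⟨h1, h2, h3⟩
    have e : ∀ x, φ x • (f - g) x = f x * φ x - g x * φ x := fun x => by
      simp only [Pi.sub_apply, smul_eq_mul]; ring
    simp_rw [e]
    rw [integral_sub (hφ.integrable_mul hf) (hφ.integrable_mul hg), h φ hφ, sub_self])
  filter_upwards [this] with x hx hxΩ
  exact sub_eq_zero.1 (hx hxΩ)

theorem HasWeakPartial.unique (hΩ : IsOpen Ω) (h₁ : HasWeakPartial Ω i f g₁)
    (h₂ : HasWeakPartial Ω i f g₂) : g₁ =ᵐ[volume.restrict Ω] g₂ :=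
  ae_eq_of_integral_test hΩ h₁.2.1 h₂.2.1 fun φ hφ => by
    have := (h₁.integral_eq hφ).symm.trans (h₂.integral_eq hφ)
    linarith

theorem HasWeakPartial.add (h₁ : HasWeakPartial Ω i f₁ g₁) (h₂ : HasWeakPartial Ω i f₂ g₂) :
    HasWeakPartial Ω i (fun x => f₁ x + f₂ x) (fun x => g₁ x + g₂ x) := by
  refine hasWeakPartial_of_integral_eq (h₁.1.add h₂.1) (h₁.2.1.add h₂.2.1) fun φ hφ => ?_
  simp_rw [add_mul]
  rw [integral_add (hφ.pd.integrable_mul h₁.1) (hφ.pd.integrable_mul h₂.1),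
    integral_add (hφ.integrable_mul h₁.2.1) (hφ.integrable_mul h₂.2.1),
    h₁.integral_eq hφ, h₂.integral_eq hφ]
  ring

theorem hasWeakPartial_const (c : ℝ) : HasWeakPartial Ω i (fun _ => c) (fun _ => 0) := by
  refine hasWeakPartial_of_integral_eq ((locallyIntegrable_const c).locallyIntegrableOn _)
    ((locallyIntegrable_const 0).locallyIntegrableOn _) fun φ hφ => ?_
  have h := integral_mul_fderiv_eq_neg_fderiv_mul_of_integrable (μ := volume) (v := basisVec i)
    (f := fun _ : Eu n => c) (g := φ)
    (by simp) (((contDiff_pd hφ.contDiff).continuous.integrable_of_hasCompactSupport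
      (hasCompactSupport_pd hφ.compact)).const_mul c)
    ((hφ.contDiff.continuous.integrable_of_hasCompactSupport hφ.compact).const_mul c)
    (fun _ _ => by fun_prop) (fun x _ => hφ.contDiff.differentiable (by simp) x)
  simpa [pd] using h

theorem HasWeakPartial.sum {ι : Type*} (s : Finset ι) {F H : ι → Eu n → ℝ}
    (h : ∀ a ∈ s, HasWeakPartial Ω i (F a) (H a)) :
    HasWeakPartial Ω i (fun x => ∑ a ∈ s, F a x) (fun x => ∑ a ∈ s, H a x) := by
  classical
  induction s using Finset.induction_on with
  | empty => simpa using hasWeakPartial_const (0 : ℝ)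
  | insert a s ha ih =>
    simp_rw [Finset.sum_insert ha]
    exact (h a (by simp)).add (ih fun b hb => h b (by simp [hb]))

/-- The weak derivative of `f` is tested against `u φ`, which is again a test function, and `∂ᵢ(u
φ)` is expanded. -/
theorem HasWeakPartial.mul_smooth (hΩ : IsOpen Ω) (hu : ContDiffOn ℝ ∞ u Ω)
    (h : HasWeakPartial Ω i f g) :
    HasWeakPartial Ω i (fun x => f x * u x)
      (fun x => f x * InverseDesign.pd i u x + g x * u x) := by
  have hu' : ContDiffOn ℝ ∞ (InverseDesign.pd i u) Ω := contDiffOn_pd hΩ hu (by simp)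
  have l1 : LocallyIntegrableOn (fun x => f x * u x) Ω volume :=
    h.1.mul_continuousOn hu.continuousOn hΩ.isLocallyClosed
  have l2 : LocallyIntegrableOn (fun x => f x * InverseDesign.pd i u x) Ω volume :=
    h.1.mul_continuousOn hu'.continuousOn hΩ.isLocallyClosed
  have l3 : LocallyIntegrableOn (fun x => g x * u x) Ω volume :=
    h.2.1.mul_continuousOn hu.continuousOn hΩ.isLocallyClosed
  refine hasWeakPartial_of_integral_eq l1 (l2.add l3) fun φ hφ => ?_
  have key := h.integral_eq (hφ.mul_left hΩ hu)
  have e : ∀ x, f x * InverseDesign.pd i (fun y => u y * φ y) x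
      = f x * u x * InverseDesign.pd i φ x + f x * InverseDesign.pd i u x * φ x := by
    intro x
    by_cases hx : x ∈ Ω
    · rw [pd_mul ((hu.contDiffAt (hΩ.mem_nhds hx)).differentiableAt (by simp))
        (hφ.contDiff.differentiable (by simp) x)]
      ring
    · rw [(hφ.mul_left hΩ hu).pd.eq_zero hx, hφ.pd.eq_zero hx, hφ.eq_zero hx]
      simp
  simp_rw [e, ← mul_assoc] at key
  rw [integral_add (hφ.pd.integrable_mul l1) (hφ.integrable_mul l2)] at key
  simp_rw [add_mul]
  rw [integral_add (hφ.integrable_mul l2) (hφ.integrable_mul l3)]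
  linarith

theorem hasWeakPartial_of_contDiffOn (hΩ : IsOpen Ω) (hu : ContDiffOn ℝ ∞ u Ω) :
    HasWeakPartial Ω i u (pd i u) := by
  simpa using (hasWeakPartial_const (Ω := Ω) (i := i) 1).mul_smooth hΩ hu

/-- A Lipschitz extension to the whole space is differentiable a.e. by Rademacher's theorem and can
be integrated by parts against test functions. On the open set `Ω` its derivative is that of `f`. -/
theorem hasWeakPartial_of_lipschitzOnWith (hΩ : IsOpen Ω) {C : NNReal}
    (hf : LipschitzOnWith C f Ω) : HasWeakPartial Ω i f (pd i f) := by
  obtain ⟨F, hF, hFf⟩ := hf.extend_real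
  have hpd : ∀ x ∈ Ω, pd i F x = pd i f x := fun x hx =>
    pd_congr ((hFf.symm.eventuallyEq_of_mem (hΩ.mem_nhds hx)))
  have hline : (fun x => lineDeriv ℝ F x (basisVec i)) =ᵐ[volume] pd i F := by
    filter_upwards [hF.ae_differentiableAt] with x hx
    exact hx.lineDeriv_eq_fderiv
  have main : HasWeakPartial Ω i F (pd i F) := by
    refine hasWeakPartial_of_integral_eq (hF.continuous.locallyIntegrable.locallyIntegrableOn _)
      (((hF.locallyIntegrable_lineDeriv _).congr hline).locallyIntegrableOn _) fun φ hφ => ?_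
    obtain ⟨D, hD⟩ := (hφ.contDiff.of_le (m := 1) (by simp)).lipschitzWith_of_hasCompactSupport
      hφ.compact (by simp)
    have h := hF.integral_lineDeriv_mul_eq (μ := volume) hD hφ.compact (basisVec i)
    have e1 : ∫ x, lineDeriv ℝ F x (basisVec i) * φ x = ∫ x, pd i F x * φ x :=
      integral_congr_ae (hline.mono fun x hx => by simp only [← hx])
    have e2 : ∀ x, lineDeriv ℝ φ x (-basisVec i) * F x = -(F x * pd i φ x) := fun x => by
      rw [(hφ.contDiff.differentiable (by simp) x).lineDeriv_eq_fderiv]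
      simp [pd, mul_comm]
    simp_rw [e2, integral_neg] at h
    rw [← e1, h, neg_neg]
  exact main.congr hΩ ((ae_restrict_mem hΩ.measurableSet).mono fun x hx => (hFf hx).symm)
    ((ae_restrict_mem hΩ.measurableSet).mono fun x hx => hpd x hx)

/-- Weak second derivatives are symmetric. -/
theorem HasWeakPartial.comm (hΩ : IsOpen Ω) {i j : Fin n} {fi fj fij fji : Eu n → ℝ}
    (hi : HasWeakPartial Ω i f fi) (hj : HasWeakPartial Ω j f fj)
    (hij : HasWeakPartial Ω j fi fij) (hji : HasWeakPartial Ω i fj fji) :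
    fij =ᵐ[volume.restrict Ω] fji := by
  refine ae_eq_of_integral_test hΩ hij.2.1 hji.2.1 fun φ hφ => ?_
  -- Both derivatives are moved onto the test function, where the order is irrelevant.
  have hc : InverseDesign.pd i (InverseDesign.pd j φ) = InverseDesign.pd j (InverseDesign.pd i φ) := by
    ext x
    have hs : IsSymmSndFDerivAt ℝ φ x := hφ.contDiff.contDiffAt.isSymmSndFDerivAt (by
      simpa using two_le_infty)
    have hd : DifferentiableAt ℝ (fderiv ℝ φ) x :=
      (hφ.contDiff.fderiv_right (m := ∞) (by simp)).differentiable (by simp) x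
    have e : ∀ a b : Fin n, InverseDesign.pd a (InverseDesign.pd b φ) x
        = fderiv ℝ (fderiv ℝ φ) x (basisVec a) (basisVec b) := fun a b => by
      unfold InverseDesign.pd
      rw [fderiv_clm_apply hd (by fun_prop)]
      simp
    rw [e, e]
    exact hs _ _
  have h1 := hij.integral_eq hφ
  have h2 := hi.integral_eq hφ.pd (φ := InverseDesign.pd j φ)
  have h3 := hji.integral_eq hφ
  have h4 := hj.integral_eq hφ.pd (φ := InverseDesign.pd i φ)
  rw [hc] at h2
  linarith

end InverseDesign

namespace InverseDesign

open Filter Topology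

variable {n : ℕ} {Ω : Set (Eu n)} {i : Fin n} {f f₁ f₂ g g₁ g₂ u φ : Eu n → ℝ}

/-! ### Mollification -/

/-- A sequence of bump functions at the origin with radii tending to zero. -/
def bump (n k : ℕ) : ContDiffBump (0 : Eu n) where
  rIn := 1 / ((k : ℝ) + 1)
  rOut := 2 / ((k : ℝ) + 1)
  rIn_pos := by positivity
  rIn_lt_rOut := by gcongr; norm_num

/-- The normalized bump functions. -/
def kern (n k : ℕ) : Eu n → ℝ := (bump n k).normed volume

/-- The `k`-th mollification of a function. -/
def moll (k : ℕ) (f : Eu n → ℝ) : Eu n → ℝ :=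
  convolution (kern n k) f (ContinuousLinearMap.lsmul ℝ ℝ) volume

theorem tendsto_bump_rOut : Tendsto (fun k => (bump n k).rOut) atTop (𝓝 0) := by
  have := (tendsto_one_div_add_atTop_nhds_zero_nat (𝕜 := ℝ)).const_mul 2
  simpa [bump, div_eq_mul_inv] using this

theorem kern_nonneg (k : ℕ) (x : Eu n) : 0 ≤ kern n k x := (bump n k).nonneg_normed x

theorem contDiff_kern (k : ℕ) {m : ℕ∞} : ContDiff ℝ m (kern n k) :=
  (bump n k).contDiff_normed

theorem hasCompactSupport_kern (k : ℕ) : HasCompactSupport (kern n k) :=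
  (bump n k).hasCompactSupport_normed

theorem integrable_kern (k : ℕ) : Integrable (kern n k) volume := (bump n k).integrable_normed

theorem moll_apply (k : ℕ) (f : Eu n → ℝ) (x : Eu n) :
    moll k f x = ∫ t, kern n k (x - t) * f t := by
  simp [moll, convolution_eq_swap]

theorem kern_sub_comm (k : ℕ) (x t : Eu n) : kern n k (x - t) = kern n k (t - x) := by
  rw [← neg_sub t x]
  exact (bump n k).normed_neg _

theorem kern_eq_zero {k : ℕ} {x t : Eu n} (h : t ∉ Metric.closedBall x (bump n k).rOut) :
    kern n k (x - t) = 0 := by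
  refine image_eq_zero_of_notMem_tsupport ?_
  rw [kern, ContDiffBump.tsupport_normed_eq]
  simpa [dist_eq_norm, norm_sub_rev x t] using h

theorem moll_congr {k : ℕ} {x : Eu n} (h : ∀ t ∈ Metric.closedBall x (bump n k).rOut, f t = g t) :
    moll k f x = moll k g x := by
  rw [moll_apply, moll_apply]
  congr 1 with t
  by_cases ht : t ∈ Metric.closedBall x (bump n k).rOut
  · rw [h t ht]
  · simp [kern_eq_zero ht]

/-- The kernel is a probability density supported in the ball, so averaging preserves the bound. -/
theorem moll_bound {k : ℕ} {x : Eu n} {M : ℝ}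
    (h : ∀ᵐ t, t ∈ Metric.closedBall x (bump n k).rOut → |f t| ≤ M) : |moll k f x| ≤ M := by
  rw [moll_apply]
  have hi : Integrable (fun t => kern n k (x - t) * M) volume :=
    ((integrable_kern k).comp_sub_left x).mul_const M
  have := norm_integral_le_of_norm_le (f := fun t => kern n k (x - t) * f t) hi (by
    filter_upwards [h] with t ht
    rw [norm_mul, Real.norm_of_nonneg (kern_nonneg _ _), Real.norm_eq_abs]
    by_cases hb : t ∈ Metric.closedBall x (bump n k).rOut
    · exact mul_le_mul_of_nonneg_left (ht hb) (kern_nonneg _ _)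
    · simp [kern_eq_zero hb])
  rw [integral_mul_const, integral_sub_left_eq_self (kern n k) volume x, kern,
    ContDiffBump.integral_normed, one_mul] at this
  exact this

theorem contDiff_moll (k : ℕ) (hf : LocallyIntegrable f volume) : ContDiff ℝ ∞ (moll k f) :=
  (hasCompactSupport_kern k).contDiff_convolution_left _ (contDiff_kern k) hf

theorem ae_tendsto_moll (hf : LocallyIntegrable f volume) :
    ∀ᵐ x, Tendsto (fun k => moll k f x) atTop (𝓝 (f x)) :=
  -- The ratio of outer to inner radius is `2` for every `k`, which is the uniform shape condition
  -- behind Lebesgue differentiation.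
  ContDiffBump.ae_convolution_tendsto_right_of_locallyIntegrable (K := 2) tendsto_bump_rOut
    (Eventually.of_forall fun k => le_of_eq (by simp only [bump]; ring)) hf

theorem isTest_kern {k : ℕ} {x : Eu n} (hx : Metric.closedBall x (bump n k).rOut ⊆ Ω) :
    IsTest Ω (fun t => kern n k (x - t)) := by
  have hs : tsupport (fun t => kern n k (x - t)) ⊆ Metric.closedBall x (bump n k).rOut := by
    refine closure_minimal (fun t ht => ?_) Metric.isClosed_closedBall
    by_contra h
    exact ht (kern_eq_zero h)
  exact ⟨(contDiff_kern k).comp (contDiff_const.sub contDiff_id),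
    HasCompactSupport.of_support_subset_isCompact (isCompact_closedBall _ _)
      (subset_closure.trans hs), hs.trans hx⟩

/-- The derivative falls on the kernel, and `t ↦ kern n k (x - t)` is an admissible test function
because the ball lies in `Ω`. The sign from the reflection `x - t` cancels the sign in the weak
derivative. Without the condition on the ball, the jump of the zero extension across the boundary
could contribute. -/
theorem pd_moll {k : ℕ} {x : Eu n} (hx : Metric.closedBall x (bump n k).rOut ⊆ Ω)
    (hf : LocallyIntegrable (Ω.indicator f) volume) (h : HasWeakPartial Ω i f g) :
    pd i (moll k (Ω.indicator f)) x = moll k (Ω.indicator g) x := by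
  have hφ := isTest_kern (Ω := Ω) hx
  have hpd : ∀ t, pd i (fun t => kern n k (x - t)) t = - pd i (kern n k) (x - t) := fun t => by
    have h1 : HasFDerivAt (fun t => kern n k (x - t))
        ((fderiv ℝ (kern n k) (x - t)).comp (-ContinuousLinearMap.id ℝ (Eu n))) t :=
      (((contDiff_kern (m := ⊤) k).differentiable (by simp)) (x - t)).hasFDerivAt.comp t
        ((hasFDerivAt_id t).const_sub x)
    simp [pd, h1.fderiv]
  have hd : pd i (moll k (Ω.indicator f)) x
      = ∫ t, pd i (kern n k) (x - t) * Ω.indicator f t := by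
    have h1 := (hasCompactSupport_kern k).hasFDerivAt_convolution_right
      (ContinuousLinearMap.lsmul ℝ ℝ).flip hf (contDiff_kern k) x
    rw [convolution_flip] at h1
    have h2 : pd i (moll k (Ω.indicator f)) x = _ :=
      congrArg (fun L => L (basisVec i)) h1.fderiv
    rw [h2, convolution_precompR_apply _ hf ((hasCompactSupport_kern k).fderiv ℝ)
      ((contDiff_kern (m := ⊤) k).continuous_fderiv (by simp))]
    simp [convolution, pd]
  rw [hd, moll_apply]
  have h3 := h.integral_eq hφ
  simp_rw [hpd] at h3
  have e1 : ∫ t, pd i (kern n k) (x - t) * Ω.indicator f t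
      = - ∫ t, f t * -pd i (kern n k) (x - t) := by
    rw [← integral_neg]
    congr 1 with t
    by_cases ht : t ∈ Ω
    · simp [ht, mul_comm]
    · have := (hφ.pd (i := i)).eq_zero ht
      rw [hpd] at this
      simp [ht, this]
  rw [e1, h3, neg_neg]
  congr 1 with t
  by_cases ht : t ∈ Ω
  · simp [ht, mul_comm]
  · simp [ht, hφ.eq_zero ht]

/-! ### Coordinate bounds and Lipschitz estimates from bounded weak gradients -/

theorem clm_apply_eq_sum (L : Eu n →L[ℝ] ℝ) (v : Eu n) : L v = ∑ i, v i * L (basisVec i) := by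
  conv_lhs => rw [← (EuclideanSpace.basisFun (Fin n) ℝ).sum_repr v]
  simp [basisVec]

theorem abs_apply_le_norm (v : Eu n) (i : Fin n) : |v i| ≤ ‖v‖ := by
  simpa using PiLp.norm_apply_le v i

theorem norm_clm_le {L : Eu n →L[ℝ] ℝ} {M : ℝ} (hM : 0 ≤ M) (h : ∀ i, |L (basisVec i)| ≤ M) :
    ‖L‖ ≤ n * M := by
  refine L.opNorm_le_bound (by positivity) fun v => ?_
  rw [clm_apply_eq_sum]
  calc ‖∑ i, v i * L (basisVec i)‖ ≤ ∑ i : Fin n, ‖v‖ * M := norm_sum_le_of_le _ fun i _ => by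
        rw [norm_mul]
        exact mul_le_mul (abs_apply_le_norm v i) (h i) (norm_nonneg _) (norm_nonneg _)
    _ = n * M * ‖v‖ := by simp; ring

theorem ae_imp_of_ae_restrict (hΩ : IsOpen Ω) {p : Eu n → Prop}
    (h : ∀ᵐ x ∂(volume.restrict Ω), p x) : ∀ᵐ x, x ∈ Ω → p x :=
  (ae_restrict_iff' hΩ.measurableSet).1 h

theorem ae_indicator_abs_le (hΩ : IsOpen Ω) {B : ℝ} (hB : 0 ≤ B)
    (h : ∀ᵐ x ∂(volume.restrict Ω), |f x| ≤ B) : ∀ᵐ x, |Ω.indicator f x| ≤ B := by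
  filter_upwards [ae_imp_of_ae_restrict hΩ h] with x hx
  by_cases hxΩ : x ∈ Ω <;> simp [hxΩ, hx, hB]

theorem locallyIntegrable_of_bound {B : ℝ} (hf : AEStronglyMeasurable f volume)
    (h : ∀ᵐ x, |f x| ≤ B) : LocallyIntegrable f volume :=
  (memLp_top_of_bound hf B h).locallyIntegrable le_top

theorem locallyIntegrable_indicator (hΩ : IsOpen Ω) {B : ℝ}
    (hf : AEStronglyMeasurable f (volume.restrict Ω))
    (h : ∀ᵐ x ∂(volume.restrict Ω), |f x| ≤ B) : LocallyIntegrable (Ω.indicator f) volume :=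
  locallyIntegrable_of_bound ((aestronglyMeasurable_indicator_iff hΩ.measurableSet).2 hf)
    (ae_indicator_abs_le hΩ (le_max_right B 0) (h.mono fun _ hx => hx.trans (le_max_left B 0)))

/-- A function with bounded weak gradient in a ball is Lipschitz near the centre, on the set of
points where its mollifications converge. -/
theorem abs_sub_le_of_weakPartial_bound {G : Fin n → Eu n → ℝ} {x₀ : Eu n} {R M : ℝ} (hM : 0 ≤ M)
    (hR : 0 < R) (hf : LocallyIntegrable (Ω.indicator f) volume)
    (h : ∀ i, HasWeakPartial Ω i f (G i)) (hball : Metric.ball x₀ R ⊆ Ω)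
    (hG : ∀ i, ∀ᵐ x, x ∈ Metric.ball x₀ R → |G i x| ≤ M) {x y : Eu n}
    (hx : x ∈ Metric.ball x₀ (R / 2)) (hy : y ∈ Metric.ball x₀ (R / 2))
    (hlx : Tendsto (fun k => moll k (Ω.indicator f) x) atTop (𝓝 (f x)))
    (hly : Tendsto (fun k => moll k (Ω.indicator f) y) atTop (𝓝 (f y))) :
    |f x - f y| ≤ n * M * ‖x - y‖ := by
  -- The estimate is proved for the mollifications and passed to the limit. Once the radius is below
  -- `R / 2`, their gradient on the half ball averages the weak gradient over points of the full
  -- ball only.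
  refine le_of_tendsto (hlx.sub hly).abs ?_
  filter_upwards [(tendsto_order.1 (tendsto_bump_rOut (n := n))).2 (R / 2) (by positivity)]
    with k hk
  have hsub : ∀ z ∈ Metric.ball x₀ (R / 2),
      Metric.closedBall z (bump n k).rOut ⊆ Metric.ball x₀ R := fun z hz =>
    Metric.closedBall_subset_ball' (by have := Metric.mem_ball.1 hz; linarith)
  refine Convex.norm_image_sub_le_of_norm_fderiv_le (𝕜 := ℝ) (s := Metric.ball x₀ (R / 2))
    (fun z _ => (contDiff_moll k hf).differentiable (by simp) z) (fun z hz => ?_)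
    (convex_ball _ _) hy hx
  refine norm_clm_le hM fun i => ?_
  change |pd i (moll k (Ω.indicator f)) z| ≤ M
  rw [pd_moll ((hsub z hz).trans hball) hf (h i)]
  refine moll_bound ?_
  filter_upwards [hG i] with t ht htz
  rw [Set.indicator_of_mem (hball (hsub z hz htz))]
  exact ht (hsub z hz htz)

/-! ### The weak product rule -/

theorem locallyIntegrableOn_mul_bounded (hΩ : IsOpen Ω) {A : ℝ}
    (hf : AEStronglyMeasurable f (volume.restrict Ω))
    (hA : ∀ᵐ x ∂(volume.restrict Ω), |f x| ≤ A) (hg : LocallyIntegrableOn g Ω volume) :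
    LocallyIntegrableOn (fun x => f x * g x) Ω volume := by
  rw [locallyIntegrableOn_iff hΩ.isLocallyClosed] at hg ⊢
  exact fun K hK hKc => (hg K hK hKc).bdd_mul (hf.mono_set hK)
    (ae_restrict_of_ae_restrict_of_subset hK hA)

/-- Fubini together with the evenness of the kernel. The bound on `f` makes the double integrand
integrable. -/
theorem integral_mul_moll {k : ℕ} (hf : Integrable f volume) (hg : Integrable g volume) {A : ℝ}
    (hA : ∀ᵐ x, |f x| ≤ A) :
    ∫ x, f x * moll k g x = ∫ x, moll k f x * g x := by
  simp_rw [moll_apply, ← integral_const_mul, ← integral_mul_const]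
  rw [integral_integral_swap]
  · congr 1 with t
    congr 1 with x
    rw [kern_sub_comm]
    ring
  · have h1 := hg.convolution_integrand (ContinuousLinearMap.lsmul ℝ ℝ)
      (integrable_kern (n := n) k) (μ := volume)
    have h2 := h1.bdd_mul (f := fun p : Eu n × Eu n => f p.1) (c := A)
      hf.aestronglyMeasurable.comp_fst
      (Measure.quasiMeasurePreserving_fst.ae hA)
    refine h2.congr (Eventually.of_forall fun p => ?_)
    simp [Function.uncurry, mul_comm]

/-- Only `f₂` is mollified, so that the product rule with a smooth factor applies, and then `k → ∞`.
Terms containing the mollification of `f₂` itself converge dominatedly, thanks to the bound on `f₂`.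
In the term with its derivative, the mollifier is moved from `g₂` to the bounded function `f₁ φ`.
Dominated convergence against `g₂` then needs no more than local integrability of `g₂`. -/
theorem HasWeakPartial.mul (hΩ : IsOpen Ω) {A B : ℝ} (h₁ : HasWeakPartial Ω i f₁ g₁)
    (h₂ : HasWeakPartial Ω i f₂ g₂) (hA : ∀ᵐ x ∂(volume.restrict Ω), |f₁ x| ≤ A)
    (hB : ∀ᵐ x ∂(volume.restrict Ω), |f₂ x| ≤ B) :
    HasWeakPartial Ω i (fun x => f₁ x * f₂ x) (fun x => f₁ x * g₂ x + g₁ x * f₂ x) := by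
  have m₁ := h₁.1.aestronglyMeasurable
  have m₂ := h₂.1.aestronglyMeasurable
  have l1 := locallyIntegrableOn_mul_bounded hΩ m₁ hA h₂.1
  have l2 := locallyIntegrableOn_mul_bounded hΩ m₁ hA h₂.2.1
  have l3 : LocallyIntegrableOn (fun x => g₁ x * f₂ x) Ω volume := by
    simpa only [mul_comm] using locallyIntegrableOn_mul_bounded hΩ m₂ hB h₁.2.1
  refine hasWeakPartial_of_integral_eq l1 (l2.add l3) fun φ hφ => ?_
  have hB' := ae_indicator_abs_le hΩ (le_max_right B 0)
    (hB.mono fun _ hx => hx.trans (le_max_left B 0))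
  set B' := max B 0
  have hH : LocallyIntegrable (Ω.indicator f₂) volume := locallyIntegrable_indicator hΩ m₂ hB
  set H : ℕ → Eu n → ℝ := fun k => moll k (Ω.indicator f₂) with hHdef
  have hHlim : ∀ᵐ x, x ∈ Ω → Tendsto (fun k => H k x) atTop (𝓝 (f₂ x)) := by
    filter_upwards [ae_tendsto_moll hH] with x hx hxΩ
    simpa [hxΩ] using hx
  have hHb : ∀ k x, |H k x| ≤ B' := fun k x => moll_bound (hB'.mono fun t ht _ => ht)
  have hHc : ∀ k, ContDiff ℝ ∞ (H k) := fun k => contDiff_moll k hH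
  -- the compactly supported factor
  set F : Eu n → ℝ := fun x => f₁ x * φ x with hFdef
  have hF : Integrable F volume := hφ.integrable_mul h₁.1
  obtain ⟨C, hC⟩ : ∃ C, ∀ x, ‖φ x‖ ≤ C := hφ.compact.exists_bound_of_continuous
    hφ.contDiff.continuous
  have hFb : ∀ᵐ x, |F x| ≤ |A| * C := by
    filter_upwards [ae_imp_of_ae_restrict hΩ hA] with x hx
    by_cases hxΩ : x ∈ Ω
    · rw [hFdef]
      simp only [abs_mul]
      exact mul_le_mul ((hx hxΩ).trans (le_abs_self A)) (hC x) (abs_nonneg _) (abs_nonneg _)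
    · simp only [hFdef, hφ.eq_zero hxΩ, mul_zero, abs_zero]
      exact mul_nonneg (abs_nonneg _) ((norm_nonneg _).trans (hC x))
  -- A compact neighbourhood of the support inside `Ω`: for radii below `δ`, the mollified `g₂` on
  -- the support of `φ` sees only the globally integrable cutoff `P`.
  obtain ⟨δ, hδ, hδΩ⟩ := hφ.compact.isCompact.exists_cthickening_subset_open hΩ hφ.subset
  set K := Metric.cthickening δ (tsupport φ)
  have hKc : IsCompact K := hφ.compact.isCompact.cthickening
  have hKm : MeasurableSet K := hKc.isClosed.measurableSet
  set P : Eu n → ℝ := K.indicator g₂ with hPdef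
  have hP : Integrable P volume :=
    (integrable_indicator_iff hKm).2 (h₂.2.1.integrableOn_compact_subset hδΩ hKc)
  -- the mollified identity
  have key : ∀ᶠ k in atTop, ∫ x, f₁ x * pd i φ x * H k x
      = - ((∫ x, moll k F x * P x) + ∫ x, g₁ x * φ x * H k x) := by
    filter_upwards [(tendsto_order.1 (tendsto_bump_rOut (n := n))).2 δ hδ] with k hk
    have hsub : ∀ x ∈ tsupport φ, Metric.closedBall x (bump n k).rOut ⊆ K := fun x hx =>
      (Metric.closedBall_subset_closedBall hk.le).trans (Metric.closedBall_subset_cthickening hx δ)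
    have h := (h₁.mul_smooth hΩ (hHc k).contDiffOn).integral_eq hφ
    have e2 : ∀ x, (f₁ x * pd i (H k) x + g₁ x * H k x) * φ x
        = F x * moll k P x + g₁ x * φ x * H k x := fun x => by
      by_cases hx : x ∈ tsupport φ
      · rw [hHdef]
        simp only
        rw [pd_moll ((hsub x hx).trans hδΩ) hH h₂, moll_congr (f := Ω.indicator g₂) (g := P)]
        · simp only [hFdef]; ring
        · intro t ht
          have := hsub x hx ht
          simp [hPdef, this, hδΩ this]
      · simp [hFdef, image_eq_zero_of_notMem_tsupport hx]
    simp_rw [e2] at h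
    have i1 : Integrable (fun x => F x * moll k P x) volume :=
      (contDiff_moll k hP.locallyIntegrable).continuous.locallyIntegrable.locallyIntegrableOn Ω
        |> fun hl => (hφ.integrable_mul (locallyIntegrableOn_mul_bounded hΩ m₁ hA hl)).congr
          (Eventually.of_forall fun x => by simp only [hFdef]; ring)
    have i2 : Integrable (fun x => g₁ x * φ x * H k x) volume :=
      ((hφ.integrable_mul h₁.2.1).bdd_mul (hHc k).continuous.aestronglyMeasurable
        (Eventually.of_forall (hHb k))).congr
          (Eventually.of_forall fun x => by simp only; ring)
    rw [integral_add i1 i2, integral_mul_moll hF hP hFb] at h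
    rw [← h]
    congr 1 with x
    ring
  have t1 : Tendsto (fun k => ∫ x, f₁ x * pd i φ x * H k x) atTop
      (𝓝 (∫ x, f₁ x * pd i φ x * f₂ x)) := by
    have hi := (hφ.pd (i := i)).integrable_mul h₁.1
    refine tendsto_integral_of_dominated_convergence (fun x => |f₁ x * pd i φ x| * B')
      (fun k => hi.aestronglyMeasurable.mul (hHc k).continuous.aestronglyMeasurable)
      (hi.abs.mul_const B') (fun k => Eventually.of_forall fun x => ?_) ?_
    · rw [norm_mul]
      exact mul_le_mul_of_nonneg_left (hHb k x) (abs_nonneg _)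
    · filter_upwards [hHlim] with x hx
      by_cases hxΩ : x ∈ Ω
      · exact (hx hxΩ).const_mul _
      · simp [hφ.pd.eq_zero hxΩ]
  have t2 : Tendsto (fun k => ∫ x, g₁ x * φ x * H k x) atTop
      (𝓝 (∫ x, g₁ x * φ x * f₂ x)) := by
    have hi := hφ.integrable_mul h₁.2.1
    refine tendsto_integral_of_dominated_convergence (fun x => |g₁ x * φ x| * B')
      (fun k => hi.aestronglyMeasurable.mul (hHc k).continuous.aestronglyMeasurable)
      (hi.abs.mul_const B') (fun k => Eventually.of_forall fun x => ?_) ?_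
    · rw [norm_mul]
      exact mul_le_mul_of_nonneg_left (hHb k x) (abs_nonneg _)
    · filter_upwards [hHlim] with x hx
      by_cases hxΩ : x ∈ Ω
      · exact (hx hxΩ).const_mul _
      · simp [hφ.eq_zero hxΩ]
  have t3 : Tendsto (fun k => ∫ x, moll k F x * P x) atTop (𝓝 (∫ x, F x * P x)) := by
    refine tendsto_integral_of_dominated_convergence (fun x => |A| * C * |P x|)
      (fun k => (contDiff_moll k hF.locallyIntegrable).continuous.aestronglyMeasurable.mul
        hP.aestronglyMeasurable)
      (hP.abs.const_mul _) (fun k => Eventually.of_forall fun x => ?_) ?_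
    · rw [norm_mul]
      exact mul_le_mul_of_nonneg_right (moll_bound (hFb.mono fun t ht _ => ht)) (abs_nonneg _)
    · filter_upwards [ae_tendsto_moll hF.locallyIntegrable] with x hx
      exact hx.mul_const _
  have hlim := tendsto_nhds_unique (t1.congr' key) ((t3.add t2).neg)
  have eFP : ∀ x, F x * P x = f₁ x * g₂ x * φ x := fun x => by
    by_cases hx : x ∈ tsupport φ
    · have hxK : x ∈ K := Metric.self_subset_cthickening _ hx
      simp only [hFdef, hPdef, Set.indicator_of_mem hxK]; ring
    · simp [hFdef, image_eq_zero_of_notMem_tsupport hx]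
  simp_rw [eFP] at hlim
  simp_rw [add_mul]
  rw [integral_add (hφ.integrable_mul l2) (hφ.integrable_mul l3)]
  have e1 : ∫ x, f₁ x * f₂ x * InverseDesign.pd i φ x = ∫ x, f₁ x * InverseDesign.pd i φ x * f₂ x := by
    congr 1 with x
    ring
  have e2 : ∫ x, g₁ x * f₂ x * φ x = ∫ x, g₁ x * φ x * f₂ x := by
    congr 1 with x
    ring
  rw [e1, e2, hlim]

end InverseDesign

namespace InverseDesign

open Filter Topology

/-! ### Closed one-forms on simply connected domains -/

/-- A copy of a type, with the discrete topology. -/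
def DiscreteCopy (F : Type*) : Type _ := F

instance (F : Type*) : TopologicalSpace (DiscreteCopy F) := ⊥

instance (F : Type*) : DiscreteTopology (DiscreteCopy F) := ⟨rfl⟩

section Primitive

variable {E F : Type*} [NormedAddCommGroup E] [NormedSpace ℝ E] [NormedAddCommGroup F]
  [NormedSpace ℝ F] {Ω : Set E} {θ : E → E →L[ℝ] F}

/-- The covering space of germs of primitives of a one-form `θ`, described by primitives `P x`
of `θ` on balls around the points `x` of `Ω`. -/
def primitiveCore (θ : E → E →L[ℝ] F) (r : Ω → ℝ) (hr : ∀ x, 0 < r x) (P : Ω → E → F)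
    (hP : ∀ x : Ω, ∀ a ∈ Metric.ball (x : E) (r x), HasFDerivAt (P x) (θ a) a) :
    FiberBundleCore Ω Ω (DiscreteCopy F) where
  baseSet x := Subtype.val ⁻¹' Metric.ball (x : E) (r x)
  isOpen_baseSet x := Metric.isOpen_ball.preimage continuous_subtype_val
  indexAt x := x
  mem_baseSet_at x := Metric.mem_ball_self (hr x)
  coordChange x y b v := show F from (show F from v) + (P x b - P y b)
  coordChange_self x b _ v := 
    (congrArg (fun z : F => (show F from v) + z) (sub_self _)).trans (add_zero (show F from v))
  continuousOn_coordChange x y := by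
    -- Two primitives differ by a constant on the intersection of two balls, which is convex. The
    -- transition maps are therefore constant in the base point, hence continuous for the discrete
    -- fibre.
    obtain ⟨c, hc⟩ := (Metric.isOpen_ball.inter Metric.isOpen_ball).exists_is_const_of_fderiv_eq_zero
      (𝕜 := ℝ) (f := fun b => P x b - P y b)
      ((convex_ball (x : E) (r x)).inter (convex_ball (y : E) (r y))).isPreconnected
      (fun a ha => ((hP x a ha.1).sub (hP y a ha.2)).differentiableAt.differentiableWithinAt)
      (fun a ha => ((hP x a ha.1).sub (hP y a ha.2)).fderiv.trans (sub_self _))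
    have : Continuous (fun p : Ω × DiscreteCopy F =>
        (show DiscreteCopy F from show F from (show F from p.2) + c)) :=
      (continuous_of_discreteTopology (f := fun v : DiscreteCopy F =>
        (show DiscreteCopy F from show F from (show F from v) + c))).comp continuous_snd
    refine this.continuousOn.congr fun p hp => ?_
    exact congrArg (fun z : F => (show F from p.2) + z) (hc p.1 hp.1)
  coordChange_comp x y z b _ v := 
    (add_assoc (show F from v) _ _).trans
      (congrArg (fun z : F => (show F from v) + z) (sub_add_sub_cancel _ _ _))

/-- A one-form with local primitives on a simply connected open set has a primitive. -/
theorem exists_primitive_of_isSimplyConnected (hΩ : IsOpen Ω) (hsc : IsSimplyConnected Ω)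
    (h : ∀ x ∈ Ω, ∃ r > 0, ∃ P : E → F, ∀ a ∈ Metric.ball x r, HasFDerivAt P (θ a) a) :
    ∃ f : E → F, ∀ a ∈ Ω, HasFDerivAt f (θ a) a := by
  choose! r hr P hP using h
  set Z := primitiveCore θ (fun x : Ω => r x) (fun x => hr x x.2) (fun x => P x)
    (fun x => hP x x.2) with hZ
  have cov : IsCoveringMap (Bundle.TotalSpace.proj : Z.TotalSpace → Ω) :=
    FiberBundle.isCoveringMap (F := DiscreteCopy F) (E := Z.Fiber)
  have : SimplyConnectedSpace Ω := hsc.simplyConnectedSpace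
  have : LocallyPathConnectedSpace Ω := hΩ.locallyPathConnectedSpace
  obtain ⟨a₀, ha₀⟩ := hsc.nonempty
  -- Simple connectedness lifts the identity of `Ω` to a global section. A point with fibre
  -- coordinate `v` over `b` stands for the germ `P b + v`, so the primitive takes the value `P b b
  -- + v` at `b`.
  obtain ⟨s, ⟨-, hs⟩, -⟩ := cov.existsUnique_continuousMap_lifts (ContinuousMap.id Ω) ⟨a₀, ha₀⟩
    (⟨⟨a₀, ha₀⟩, (show F from 0)⟩ : Z.TotalSpace) rfl
  have hproj : ∀ b, (s b).proj = b := fun b => congrFun hs b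
  let v : Ω → F := fun b => (s b).2
  classical
  let f : E → F := fun a => if ha : a ∈ Ω then P a a + v ⟨a, ha⟩ else 0
  refine ⟨f, fun a ha => ?_⟩
  let x : Ω := ⟨a, ha⟩
  have hcont : ContinuousAt (fun b => (Z.localTriv x (s b)).2) x := by
    have h1 : ContinuousAt (Z.localTriv x) (s x) :=
      (Z.localTriv x).continuousAt (by
        rw [(Z.localTriv x).mem_source]
        change (s x).proj ∈ Z.baseSet x
        rw [hproj]
        exact Z.mem_baseSet_at x)
    exact continuous_snd.continuousAt.comp (h1.comp s.continuous.continuousAt)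
  -- A continuous map into a discrete fibre is locally constant, so near `a` the section is a single
  -- primitive `P a + c`.
  have hloc : ∀ᶠ b in 𝓝 x, (Z.localTriv x (s b)).2 = (Z.localTriv x (s x)).2 :=
    hcont.eventually (IsOpen.mem_nhds (isOpen_discrete {(Z.localTriv x (s x)).2}) rfl)
  have hval : ∀ b, (Z.localTriv x (s b)).2 = (show F from v b + (P b b - P a b)) := by
    intro b
    change (show F from v b) + (P (s b).proj (s b).proj - P a (s b).proj) = _
    rw [hproj]
  obtain ⟨c, hc⟩ : ∃ c : F, ∀ᶠ b : Ω in 𝓝 x, v b + (P b b - P a b) = c :=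
    ⟨(Z.localTriv x (s x)).2, hloc.mono fun b hb => (hval b).symm.trans hb⟩
  have hc' : ∀ᶠ b in 𝓝 a, ∀ hb : b ∈ Ω, v ⟨b, hb⟩ + (P b b - P a b) = c := by
    have h1 : ∀ᶠ b in Filter.map Subtype.val (𝓝 x), ∀ hb : b ∈ Ω,
        v ⟨b, hb⟩ + (P b b - P a b) = c := Filter.eventually_map.2 (hc.mono fun b hb _ => hb)
    rwa [hΩ.isOpenEmbedding_subtypeVal.map_nhds_eq x] at h1
  have hEq : f =ᶠ[𝓝 a] fun b => P a b + c := by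
    filter_upwards [hc', hΩ.mem_nhds ha] with b hb hbΩ
    simp only [f, hbΩ, dite_true]
    rw [← hb hbΩ]
    abel
  exact ((hP a ha a (Metric.mem_ball_self (hr a ha))).add_const c).congr_of_eventuallyEq hEq

end Primitive

end InverseDesign

namespace InverseDesign

open Filter Topology

variable {n : ℕ}

/-! ### Pointwise algebra of the total differential system -/

/-- The matrices `∂ₖ g` of partial derivatives at `x`. -/
def pdMat (g : MatField n) (x : Eu n) (k : Fin n) : Matrix (Fin n) (Fin n) ℝ :=
  Matrix.of fun p q => pd k (fun y => g y p q) x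

/-- The Christoffel symbols in terms of the inverse metric and the derivatives of the metric. -/
def chr (gi : Matrix (Fin n) (Fin n) ℝ) (d : Fin n → Matrix (Fin n) (Fin n) ℝ)
    (m i j : Fin n) : ℝ :=
  (1 / 2) * ∑ k, gi m k * (d j k i + d i k j - d k i j)

/-- The part of `totalRHS` that does not involve `Γ̃`. -/
def corr (gi : Matrix (Fin n) (Fin n) ℝ) (d : Fin n → Matrix (Fin n) (Fin n) ℝ)
    (w : Matrix (Fin n) (Fin n) ℝ) (s i j : Fin n) : ℝ :=
  (1 / 2) * ∑ m, gi s m * ((∑ p, w p i * d j m p) + (∑ p, w p j * d i m p)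
    - ∑ p, ∑ q, ∑ t, w p j * w q i * d t p q * w⁻¹ t m)

theorem christoffel_eq_chr (g : MatField n) (m i j : Fin n) (x : Eu n) :
    christoffel g m i j x = chr (g x)⁻¹ (pdMat g x) m i j := rfl

theorem totalRHS_eq (G Gt w : MatField n) (s i j : Fin n) (x : Eu n) :
    totalRHS G Gt w s i j x = (∑ m, w x s m * chr (Gt x)⁻¹ (pdMat Gt x) m i j)
      - corr (G x)⁻¹ (pdMat G x) (w x) s i j := rfl

/-- The derivative of `wᵀ g w`, where `H s i k = ∂ₖ wᵢˢ`. -/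
def dPull (g w : Matrix (Fin n) (Fin n) ℝ) (d : Fin n → Matrix (Fin n) (Fin n) ℝ)
    (H : Fin n → Fin n → Fin n → ℝ) (k i j : Fin n) : ℝ :=
  (∑ s, ∑ t, H s i k * g s t * w t j) + (∑ s, ∑ t, w s i * d k s t * w t j)
    + ∑ s, ∑ t, w s i * g s t * H t j k

variable {g gt w : Matrix (Fin n) (Fin n) ℝ} {d dt : Fin n → Matrix (Fin n) (Fin n) ℝ}
  {H : Fin n → Fin n → Fin n → ℝ}

theorem chr_symm (hdt : ∀ k, (dt k).IsSymm) (gi : Matrix (Fin n) (Fin n) ℝ) (m i j : Fin n) :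
    chr gi dt m i j = chr gi dt m j i := by
  unfold chr
  congr 1
  refine Finset.sum_congr rfl fun k _ => ?_
  rw [(hdt k).apply i j]
  ring

/-- The vector `yₘ = wᵢᵖ dⱼ gₘₚ + wⱼᵖ dᵢ gₘₚ`. -/
def yvec (d : Fin n → Matrix (Fin n) (Fin n) ℝ) (w : Matrix (Fin n) (Fin n) ℝ) (i j : Fin n) :
    Fin n → ℝ := fun m => (∑ p, w p i * d j m p) + ∑ p, w p j * d i m p

/-- The vector `zₖ = wⱼᵖ wᵢ^q dₖ g_pq`. -/
def zvec (d : Fin n → Matrix (Fin n) (Fin n) ℝ) (w : Matrix (Fin n) (Fin n) ℝ) (i j : Fin n) :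
    Fin n → ℝ := fun k => ∑ p, ∑ q, w p j * w q i * d k p q

theorem corr_eq (gi : Matrix (Fin n) (Fin n) ℝ) (s i j : Fin n) :
    corr gi d w s i j
      = ((1 / 2 : ℝ) • gi *ᵥ (yvec d w i j - w⁻¹ᵀ *ᵥ zvec d w i j)) s := by
  simp only [corr, Pi.smul_apply, smul_eq_mul, Matrix.mulVec, dotProduct, Pi.sub_apply, yvec,
    zvec, Matrix.transpose_apply]
  congr 1
  refine Finset.sum_congr rfl fun m _ => ?_
  congr 2
  simp_rw [Finset.mul_sum]
  rw [Finset.sum_comm_cycle]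
  exact Finset.sum_congr rfl fun t _ => Finset.sum_congr rfl fun p _ =>
    Finset.sum_congr rfl fun q _ => by ring

theorem zvec_symm (hd : ∀ k, (d k).IsSymm) (i j : Fin n) : zvec d w i j = zvec d w j i := by
  ext k
  simp only [zvec]
  rw [Finset.sum_comm]
  refine Finset.sum_congr rfl fun p _ => Finset.sum_congr rfl fun q _ => ?_
  rw [(hd k).apply p q]
  ring

theorem yvec_symm (i j : Fin n) : yvec d w i j = yvec d w j i := by
  ext k
  simp only [yvec, add_comm]

theorem corr_symm (hd : ∀ k, (d k).IsSymm) (gi : Matrix (Fin n) (Fin n) ℝ) (s i j : Fin n) :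
    corr gi d w s i j = corr gi d w s j i := by
  rw [corr_eq, corr_eq, zvec_symm hd, yvec_symm]

/-- The first Christoffel combination of the derivatives of `wᵀ g w`. -/
theorem christoffel_combination (hg : g.IsSymm) (hd : ∀ k, (d k).IsSymm)
    (hH : ∀ s i j, H s i j = H s j i) (i j k : Fin n) :
    dPull g w d H j k i + dPull g w d H i k j - dPull g w d H k i j
      = (wᵀ *ᵥ ((2 : ℝ) • (g *ᵥ fun s => H s i j) + yvec d w i j) - zvec d w i j) k := by
  -- Of the six terms containing `H`, four cancel in pairs by `e1` and `e2`, and `e3` identifies the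
  -- remaining two.
  have e1 : ∑ s, ∑ t, H s k j * g s t * w t i = ∑ s, ∑ t, w s i * g s t * H t j k := by
    rw [Finset.sum_comm]
    refine Finset.sum_congr rfl fun p _ => Finset.sum_congr rfl fun q _ => ?_
    rw [hg.apply p q, hH q k j]
    ring
  have e2 : ∑ s, ∑ t, H s k i * g s t * w t j = ∑ s, ∑ t, H s i k * g s t * w t j := by
    simp_rw [hH _ k i]
  have e3 : ∑ s, ∑ t, w s k * g s t * H t j i = ∑ s, ∑ t, w s k * g s t * H t i j := by
    simp_rw [hH _ j i]
  have e4 : (wᵀ *ᵥ ((2 : ℝ) • (g *ᵥ fun s => H s i j) + yvec d w i j) - zvec d w i j) k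
      = 2 * (∑ s, ∑ t, w s k * g s t * H t i j) + (∑ s, ∑ t, w s k * d j s t * w t i)
        + (∑ s, ∑ t, w s k * d i s t * w t j) - ∑ s, ∑ t, w s i * d k s t * w t j := by
    simp only [Matrix.mulVec, dotProduct, Pi.sub_apply, Pi.add_apply, Pi.smul_apply, yvec, zvec,
      Matrix.transpose_apply, smul_eq_mul]
    congr 1
    · simp_rw [mul_add, Finset.sum_add_distrib, Finset.mul_sum]
      rw [← add_assoc]
      congr 1
      · congr 1
        all_goals exact Finset.sum_congr rfl fun p _ => Finset.sum_congr rfl fun q _ => by ring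
      · exact Finset.sum_congr rfl fun p _ => Finset.sum_congr rfl fun q _ => by ring
    · rw [Finset.sum_comm]
      refine Finset.sum_congr rfl fun p _ => Finset.sum_congr rfl fun q _ => ?_
      rw [(hd k).apply p q]
      ring
  rw [e4]
  simp only [dPull]
  rw [e1, e2, e3]
  ring

theorem mul_inv_pull (hw : IsUnit w) :
    w * (wᵀ * g * w)⁻¹ * wᵀ = g⁻¹ := by
  have hw' := (Matrix.isUnit_iff_isUnit_det w).1 hw
  have hwt : IsUnit wᵀ.det := by rwa [Matrix.det_transpose]
  rw [Matrix.mul_inv_rev, Matrix.mul_inv_rev, ← mul_assoc, Matrix.mul_nonsing_inv _ hw', one_mul,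
    mul_assoc, Matrix.nonsing_inv_mul _ hwt, mul_one]

theorem mul_inv_pull' (hw : IsUnit w) :
    w * (wᵀ * g * w)⁻¹ = g⁻¹ * w⁻¹ᵀ := by
  have hw' := (Matrix.isUnit_iff_isUnit_det w).1 hw
  rw [Matrix.mul_inv_rev, Matrix.mul_inv_rev, ← mul_assoc, Matrix.mul_nonsing_inv _ hw', one_mul,
    Matrix.transpose_nonsing_inv]

/-- The algebraic constraint determines the derivatives of `w`. -/
theorem eq_total_of_pull (hgu : IsUnit g) (hw : IsUnit w) (hg : g.IsSymm)
    (hd : ∀ k, (d k).IsSymm) (hH : ∀ s i j, H s i j = H s j i) (ha : gt = wᵀ * g * w)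
    (hdt : ∀ k i j, dt k i j = dPull g w d H k i j) (s i j : Fin n) :
    H s i j = (∑ m, w s m * chr gt⁻¹ dt m i j) - corr g⁻¹ d w s i j := by
  have hX : (fun m => chr gt⁻¹ dt m i j) = (1 / 2 : ℝ) • gt⁻¹ *ᵥ
      (wᵀ *ᵥ ((2 : ℝ) • (g *ᵥ fun s => H s i j) + yvec d w i j) - zvec d w i j) := by
    ext m
    simp only [chr, hdt, christoffel_combination hg hd hH]
    simp [Matrix.mulVec, dotProduct]
  have h1 : (∑ m, w s m * chr gt⁻¹ dt m i j) = (w *ᵥ fun m => chr gt⁻¹ dt m i j) s := rfl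
  rw [h1, hX, corr_eq]
  have hgd := (Matrix.isUnit_iff_isUnit_det g).1 hgu
  -- With `gt = wᵀ g w` one has `w gt⁻¹ wᵀ = g⁻¹` and `w gt⁻¹ = g⁻¹ w⁻ᵀ`, so multiplication by `w`
  -- isolates `H`.
  have key : w *ᵥ ((1 / 2 : ℝ) • gt⁻¹ *ᵥ
      (wᵀ *ᵥ ((2 : ℝ) • (g *ᵥ fun s => H s i j) + yvec d w i j) - zvec d w i j))
      = (fun s => H s i j) + (1 / 2 : ℝ) • g⁻¹ *ᵥ (yvec d w i j - w⁻¹ᵀ *ᵥ zvec d w i j) := by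
    rw [Matrix.mulVec_smul, Matrix.mulVec_mulVec, Matrix.mulVec_sub, Matrix.mulVec_mulVec, ha,
      mul_inv_pull hw, mul_inv_pull' hw, Matrix.mulVec_add, Matrix.mulVec_smul,
      Matrix.mulVec_mulVec, Matrix.nonsing_inv_mul _ hgd, Matrix.one_mulVec, Matrix.mulVec_sub,
      Matrix.mulVec_mulVec]
    module
  rw [key]
  simp

/-- Along the total differential system, the derivative of `wᵀ g w` is given by `Γ̃`. -/
theorem dPull_eq_of_total (hgu : IsUnit g) (hw : IsUnit w) (hg : g.IsSymm)
    (hd : ∀ k, (d k).IsSymm) {Γ : Fin n → Fin n → Fin n → ℝ}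
    (hH : ∀ s i j, H s i j = (∑ m, w s m * Γ m i j) - corr g⁻¹ d w s i j) (k i j : Fin n) :
    dPull g w d H k i j = (∑ m, Γ m i k * (wᵀ * g * w) m j)
      + ∑ m, Γ m j k * (wᵀ * g * w) i m := by
  have hgd := (Matrix.isUnit_iff_isUnit_det g).1 hgu
  have hw' := (Matrix.isUnit_iff_isUnit_det w).1 hw
  have hwt : IsUnit wᵀ.det := by rwa [Matrix.det_transpose]
  have key : ∀ a b, (wᵀ * g) *ᵥ (fun s => H s a b) = (wᵀ * g * w) *ᵥ (fun m => Γ m a b)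
      - (1 / 2 : ℝ) • (wᵀ *ᵥ yvec d w a b - zvec d w a b) := fun a b => by
    have h1 : (fun s => H s a b) = w *ᵥ (fun m => Γ m a b)
        - (1 / 2 : ℝ) • g⁻¹ *ᵥ (yvec d w a b - w⁻¹ᵀ *ᵥ zvec d w a b) := by
      ext s
      rw [hH, corr_eq]
      rfl
    rw [h1, Matrix.mulVec_sub, Matrix.mulVec_mulVec, Matrix.mulVec_smul, Matrix.mulVec_mulVec,
      mul_assoc wᵀ g g⁻¹, Matrix.mul_nonsing_inv _ hgd, mul_one, Matrix.mulVec_sub,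
      Matrix.mulVec_mulVec, ← Matrix.transpose_mul, Matrix.nonsing_inv_mul _ hw',
      Matrix.transpose_one, Matrix.one_mulVec]
  have ev : ∀ a b c, ∑ s, ∑ t, w s c * g s t * H t a b
      = (∑ m, Γ m a b * (wᵀ * g * w) c m) - (1 / 2) * ((∑ s, ∑ t, w s c * d b s t * w t a)
        + (∑ s, ∑ t, w s c * d a s t * w t b) - ∑ s, ∑ t, w s b * d c s t * w t a) := by
    intro a b c
    have h := congrFun (key a b) c
    have e1 : ((wᵀ * g) *ᵥ (fun s => H s a b)) c = ∑ s, ∑ t, w s c * g s t * H t a b := by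
      simp only [Matrix.mulVec, dotProduct, Matrix.mul_apply, Finset.sum_mul,
        Matrix.transpose_apply]
      rw [Finset.sum_comm]
    have e2 : ((wᵀ * g * w) *ᵥ (fun m => Γ m a b)) c = ∑ m, Γ m a b * (wᵀ * g * w) c m := by
      simp only [Matrix.mulVec, dotProduct, mul_comm]
    have e3 : (wᵀ *ᵥ yvec d w a b) c = (∑ s, ∑ t, w s c * d b s t * w t a)
        + ∑ s, ∑ t, w s c * d a s t * w t b := by
      simp only [Matrix.mulVec, dotProduct, yvec, Matrix.transpose_apply, mul_add,
        Finset.sum_add_distrib, Finset.mul_sum]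
      congr 1 <;>
        exact Finset.sum_congr rfl fun p _ => Finset.sum_congr rfl fun q _ => by ring
    have e4 : zvec d w a b c = ∑ s, ∑ t, w s b * d c s t * w t a :=
      Finset.sum_congr rfl fun p _ => Finset.sum_congr rfl fun q _ => by ring
    rw [e1, Pi.sub_apply, e2, Pi.smul_apply, Pi.sub_apply, e3, e4] at h
    rw [h, smul_eq_mul]
  have sw : ∀ (a b c : Fin n), ∑ s, ∑ t, w s a * d c s t * w t b
      = ∑ s, ∑ t, w s b * d c s t * w t a := fun a b c => by
    rw [Finset.sum_comm]
    refine Finset.sum_congr rfl fun p _ => Finset.sum_congr rfl fun q _ => ?_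
    rw [(hd c).apply p q]
    ring
  have e1 : ∑ s, ∑ t, H s i k * g s t * w t j = ∑ s, ∑ t, w s j * g s t * H t i k := by
    rw [Finset.sum_comm]
    refine Finset.sum_congr rfl fun p _ => Finset.sum_congr rfl fun q _ => ?_
    rw [hg.apply p q]
    ring
  have hS : (wᵀ * g * w).IsSymm := by
    unfold Matrix.IsSymm
    simp [Matrix.transpose_mul, hg.eq, mul_assoc]
  -- The two `H` terms of `dPull` are instances of `ev`. Their parts `-½ wᵢ · dₖ wⱼ` add up to
  -- cancel the middle term of `dPull`, and the other derivatives of `g` cancel each other by the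
  -- symmetry `sw`.
  simp only [dPull]
  rw [e1, ev i k j, ev j k i, sw j i k, sw j k i, sw i k j]
  simp_rw [hS.apply _ j]
  ring

/-- In terms of a metric whose derivatives are related by the chain rule, the correction term
is the pullback of the Christoffel symbols. -/
theorem corr_eq_chr {da : Fin n → Matrix (Fin n) (Fin n) ℝ} (hw : IsUnit w)
    (hda : ∀ k, (da k).IsSymm) (hd : ∀ k p q, d k p q = ∑ r, w r k * da r p q)
    (gi : Matrix (Fin n) (Fin n) ℝ) (s i j : Fin n) :
    corr gi d w s i j = ∑ p, ∑ r, w p i * w r j * chr gi da s p r := by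
  have hw' := (Matrix.isUnit_iff_isUnit_det w).1 hw
  have hz : w⁻¹ᵀ *ᵥ zvec d w i j = fun m => ∑ p, ∑ q, w p j * w q i * da m p q := by
    have : zvec d w i j = wᵀ *ᵥ fun m => ∑ p, ∑ q, w p j * w q i * da m p q := by
      ext k
      simp only [zvec, hd, Matrix.mulVec, dotProduct, Matrix.transpose_apply, Finset.mul_sum]
      rw [Finset.sum_comm_cycle]
      refine Finset.sum_congr rfl fun m _ => ?_
      refine Finset.sum_congr rfl fun p _ => Finset.sum_congr rfl fun q _ => by ring
    rw [this, Matrix.mulVec_mulVec, ← Matrix.transpose_mul, Matrix.mul_nonsing_inv _ hw',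
      Matrix.transpose_one, Matrix.one_mulVec]
  have hy : yvec d w i j = fun m => ∑ p, ∑ r, w p i * w r j * (da r m p + da p m r) := by
    ext m
    simp only [yvec, hd, mul_add, Finset.sum_add_distrib, Finset.mul_sum]
    congr 1
    · exact Finset.sum_congr rfl fun p _ => Finset.sum_congr rfl fun q _ => by ring
    · rw [Finset.sum_comm]
      exact Finset.sum_congr rfl fun p _ => Finset.sum_congr rfl fun q _ => by ring
  have hyz : ∀ m, yvec d w i j m - ∑ p, ∑ q, w p j * w q i * da m p q
      = ∑ p, ∑ r, w p i * w r j * (da r m p + da p m r - da m p r) := fun m => by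
    rw [hy, Finset.sum_comm (f := fun p q => w p j * w q i * da m p q)]
    simp only [← Finset.sum_sub_distrib]
    refine Finset.sum_congr rfl fun p _ => Finset.sum_congr rfl fun q _ => ?_
    rw [(hda m).apply p q]
    ring
  rw [corr_eq, hz]
  simp only [Pi.smul_apply, smul_eq_mul, Matrix.mulVec, dotProduct, Pi.sub_apply, chr,
    hyz, Finset.mul_sum]
  rw [← Finset.sum_comm_cycle]
  exact Finset.sum_congr rfl fun p _ => Finset.sum_congr rfl fun r _ =>
    Finset.sum_congr rfl fun m _ => by ring

end InverseDesign

namespace InverseDesign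

open Filter Topology

variable {n : ℕ} {Ω : Set (Eu n)} {f g : Eu n → ℝ}

/-! ### Continuous representatives and differentiability -/

/-- `f` is locally essentially bounded in `Ω`. -/
def LocBdd (Ω : Set (Eu n)) (f : Eu n → ℝ) : Prop :=
  ∀ x ∈ Ω, ∃ U ∈ 𝓝 x, ∃ M : ℝ, ∀ᵐ y, y ∈ U → |f y| ≤ M

theorem LocBdd.add (hf : LocBdd Ω f) (hg : LocBdd Ω g) : LocBdd Ω (fun x => f x + g x) := by
  intro x hx
  obtain ⟨U, hU, M, hM⟩ := hf x hx
  obtain ⟨V, hV, N, hN⟩ := hg x hx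
  refine ⟨U ∩ V, inter_mem hU hV, M + N, ?_⟩
  filter_upwards [hM, hN] with y h1 h2 hy
  exact (abs_add_le _ _).trans (add_le_add (h1 hy.1) (h2 hy.2))

theorem LocBdd.mul (hf : LocBdd Ω f) (hg : LocBdd Ω g) : LocBdd Ω (fun x => f x * g x) := by
  intro x hx
  obtain ⟨U, hU, M, hM⟩ := hf x hx
  obtain ⟨V, hV, N, hN⟩ := hg x hx
  refine ⟨U ∩ V, inter_mem hU hV, M * N, ?_⟩
  filter_upwards [hM, hN] with y h1 h2 hy
  rw [abs_mul]
  exact mul_le_mul (h1 hy.1) (h2 hy.2) (abs_nonneg _) ((abs_nonneg _).trans (h1 hy.1))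

theorem locBdd_const (c : ℝ) : LocBdd Ω (fun _ => c) :=
  fun _ _ => ⟨Set.univ, univ_mem, |c|, Eventually.of_forall fun _ _ => le_rfl⟩

theorem LocBdd.sub (hf : LocBdd Ω f) (hg : LocBdd Ω g) : LocBdd Ω (fun x => f x - g x) := by
  simpa [sub_eq_add_neg] using hf.add ((locBdd_const (-1)).mul hg)

theorem LocBdd.sum {ι : Type*} (s : Finset ι) {F : ι → Eu n → ℝ}
    (h : ∀ a ∈ s, LocBdd Ω (F a)) : LocBdd Ω (fun x => ∑ a ∈ s, F a x) := by
  classical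
  induction s using Finset.induction_on with
  | empty => simpa using locBdd_const (0 : ℝ)
  | insert a s ha ih =>
    simp_rw [Finset.sum_insert ha]
    exact (h a (by simp)).add (ih fun b hb => h b (by simp [hb]))

theorem LocBdd.prod {ι : Type*} (s : Finset ι) {F : ι → Eu n → ℝ}
    (h : ∀ a ∈ s, LocBdd Ω (F a)) : LocBdd Ω (fun x => ∏ a ∈ s, F a x) := by
  classical
  induction s using Finset.induction_on with
  | empty => simpa using locBdd_const (1 : ℝ)
  | insert a s ha ih =>
    simp_rw [Finset.prod_insert ha]
    exact (h a (by simp)).mul (ih fun b hb => h b (by simp [hb]))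

theorem locBdd_of_continuousOn (hΩ : IsOpen Ω) (hf : ContinuousOn f Ω) : LocBdd Ω f := by
  intro x hx
  have h := (hf.continuousAt (hΩ.mem_nhds hx)).abs.eventually (gt_mem_nhds (lt_add_one |f x|))
  exact ⟨_, h, |f x| + 1, Eventually.of_forall fun y hy => le_of_lt hy⟩

theorem locBdd_of_ae_bound (hΩ : IsOpen Ω) {C : ℝ}
    (h : ∀ᵐ x ∂(volume.restrict Ω), |f x| ≤ C) : LocBdd Ω f :=
  fun _ hx => ⟨Ω, hΩ.mem_nhds hx, C, ae_imp_of_ae_restrict hΩ h⟩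

theorem exists_mem_of_ae {p : Eu n → Prop} (h : ∀ᵐ x, p x) {x : Eu n} {U : Set (Eu n)}
    (hU : U ∈ 𝓝 x) : ∃ y ∈ U, p y := by
  obtain ⟨y, hyU, hy⟩ := (Measure.dense_of_ae h).inter_nhds_nonempty hU
  exact ⟨y, hy, hyU⟩

/-- A bounded function with locally bounded weak gradient has a continuous representative. -/
theorem exists_continuousOn_ae_eq (hΩ : IsOpen Ω) {G : Fin n → Eu n → ℝ}
    (hf : LocallyIntegrable (Ω.indicator f) volume) (h : ∀ i, HasWeakPartial Ω i f (G i))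
    (hG : ∀ i, LocBdd Ω (G i)) : ∃ F : Eu n → ℝ, ContinuousOn F Ω ∧ ∀ᵐ x, x ∈ Ω → F x = f x := by
  set S : Set (Eu n) := {x | Tendsto (fun k => moll k (Ω.indicator f) x) atTop (𝓝 (f x))}
  have hS : ∀ᵐ x, x ∈ Ω → x ∈ S := by
    filter_upwards [ae_tendsto_moll hf] with x hx hxΩ
    simpa [S, hxΩ] using hx
  have hcl : Ω ⊆ closure (Ω ∩ S) := by
    intro x hx
    rw [mem_closure_iff_nhds]
    intro U hU
    obtain ⟨y, hy, hyS⟩ := exists_mem_of_ae hS (inter_mem hU (hΩ.mem_nhds hx))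
    exact ⟨y, hy.1, hy.2, hyS hy.2⟩
  -- Near each point of `Ω`, `f` is Lipschitz on the dense set `S` where its mollifications
  -- converge. It therefore has a limit along `S` at every point, and these limits form the
  -- continuous representative.
  have hlip : ∀ x ∈ Ω, ∃ y : ℝ, Tendsto f (𝓝[Ω ∩ S] x) (𝓝 y) ∧ (x ∈ S → y = f x) := by
    intro x hx
    choose U hU M hM using fun i => hG i x hx
    have hU' : (⋂ i, U i) ∩ Ω ∈ 𝓝 x := inter_mem (Filter.iInter_mem.2 hU) (hΩ.mem_nhds hx)
    obtain ⟨R, hR, hball⟩ := Metric.mem_nhds_iff.1 hU'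
    have hMi : ∀ i, M i ≤ ∑ j, |M j| := fun i =>
      (le_abs_self _).trans (Finset.single_le_sum (f := fun j => |M j|)
        (fun j _ => abs_nonneg _) (Finset.mem_univ i))
    have hC : 0 ≤ ∑ j, |M j| := Finset.sum_nonneg fun j _ => abs_nonneg _
    have hL : LipschitzOnWith (Real.toNNReal (n * ∑ j, |M j|)) f
        (S ∩ Metric.ball x (R / 2)) := by
      refine LipschitzOnWith.of_dist_le_mul fun y hy z hz => ?_
      rw [Real.coe_toNNReal _ (by positivity), Real.dist_eq, dist_eq_norm]
      refine abs_sub_le_of_weakPartial_bound hC hR hf h (fun y hy => (hball hy).2) (fun i => ?_)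
        hy.2 hz.2 hy.1 hz.1
      filter_upwards [hM i] with t ht htb
      exact (ht (Set.mem_iInter.1 (hball htb).1 i)).trans (hMi i)
    obtain ⟨F, hF, hFf⟩ := hL.extend_real
    have hxb : Metric.ball x (R / 2) ∈ 𝓝 x := Metric.ball_mem_nhds x (by positivity)
    refine ⟨F x, ?_, fun hxS => (hFf ⟨hxS, mem_of_mem_nhds hxb⟩).symm⟩
    refine ((hF.continuous.tendsto x).mono_left nhdsWithin_le_nhds).congr' ?_
    filter_upwards [self_mem_nhdsWithin, mem_nhdsWithin_of_mem_nhds hxb] with y hy hyb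
    exact (hFf ⟨hy.2, hyb⟩).symm
  refine ⟨extendFrom (Ω ∩ S) f, continuousOn_extendFrom hcl fun x hx => ?_, ?_⟩
  · obtain ⟨y, hy, -⟩ := hlip x hx
    exact ⟨y, hy⟩
  · filter_upwards [hS] with x hxS hx
    obtain ⟨y, hy, hyx⟩ := hlip x hx
    rw [extendFrom_eq (hcl hx) hy, hyx (hxS hx)]

/-- Convergence at a given point, instead of almost every point, is what allows derivatives to be
computed everywhere. -/
theorem tendsto_moll_of_continuousAt (hf : AEStronglyMeasurable f volume) {x : Eu n}
    (hc : ContinuousAt f x) : Tendsto (fun k => moll k f x) atTop (𝓝 (f x)) := by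
  rw [Metric.tendsto_nhds]
  intro ε hε
  obtain ⟨δ, hδ, h⟩ := Metric.continuousAt_iff.1 hc (ε / 2) (by positivity)
  filter_upwards [(tendsto_order.1 (tendsto_bump_rOut (n := n))).2 δ hδ] with k hk
  refine lt_of_le_of_lt ((bump n k).dist_normed_convolution_le hf fun y hy => ?_)
    (half_lt_self hε)
  exact (h ((Metric.mem_ball.1 hy).trans hk)).le

/-- The linear form with given values on the standard basis. -/
def linForm (c : Fin n → ℝ) : Eu n →L[ℝ] ℝ := ∑ i, c i • EuclideanSpace.proj i

theorem linForm_apply (c : Fin n → ℝ) (v : Eu n) : linForm c v = ∑ i, c i * v i := by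
  simp [linForm]

theorem linForm_basisVec (c : Fin n → ℝ) (i : Fin n) : linForm c (basisVec i) = c i := by
  simp [linForm_apply, basisVec]

/-- A continuous function with continuous weak gradient is differentiable. -/
theorem hasFDerivAt_of_weakPartial (hΩ : IsOpen Ω) {G : Fin n → Eu n → ℝ}
    (hf : LocallyIntegrable (Ω.indicator f) volume) (hfc : ContinuousOn f Ω)
    (h : ∀ i, HasWeakPartial Ω i f (G i)) (hG : ∀ i, ContinuousOn (G i) Ω) {x : Eu n}
    (hx : x ∈ Ω) : HasFDerivAt f (linForm fun i => G i x) x := by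
  set L := linForm fun i => G i x with hL
  refine HasFDerivAt.of_isLittleO (Asymptotics.isLittleO_iff.2 fun c hc => ?_)
  -- The denominator `n + 1` gives `n * η ≤ c` and stays positive when `n = 0`.
  set η := c / (n + 1) with hη
  have hη0 : 0 < η := by positivity
  have hnη : n * η ≤ c := by
    rw [hη, mul_div_assoc', div_le_iff₀ (by positivity)]
    nlinarith
  have hev : ∀ i, ∀ᶠ y in 𝓝 x, |G i y - G i x| < η := fun i =>
    (Metric.tendsto_nhds.1 ((hG i).continuousAt (hΩ.mem_nhds hx)) η hη0)
  obtain ⟨R, hR, hball⟩ := Metric.mem_nhds_iff.1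
    (inter_mem (Filter.eventually_all.2 hev) (hΩ.mem_nhds hx))
  -- Subtracting the candidate derivative leaves a function whose weak gradient is below `η` near
  -- `x`. Its Lipschitz estimate is exactly the little-o bound.
  set f₁ : Eu n → ℝ := fun y => f y + (-L) y with hf₁
  have hi : LocallyIntegrable (Ω.indicator f₁) volume := by
    have : Ω.indicator f₁ = Ω.indicator f + Ω.indicator (-L : Eu n →L[ℝ] ℝ) :=
      Set.indicator_add Ω f _
    rw [this]
    exact hf.add ((-L).continuous.locallyIntegrable.indicator hΩ.measurableSet)
  have hw : ∀ i, HasWeakPartial Ω i f₁ (fun y => G i y + - G i x) := fun i => by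
    refine ((h i).add (hasWeakPartial_of_contDiffOn hΩ (-L).contDiff.contDiffOn)).congr hΩ
      (Eventually.of_forall fun _ => rfl) (Eventually.of_forall fun y => ?_)
    simp only [pd]
    rw [(-L).fderiv]
    simp [hL, linForm_basisVec]
  have hc₁ : ∀ y ∈ Ω, Tendsto (fun k => moll k (Ω.indicator f₁) y) atTop (𝓝 (f₁ y)) := by
    intro y hy
    have hca : ContinuousAt (Ω.indicator f₁) y := by
      refine ContinuousAt.congr (f := f₁) ?_ ?_
      · exact (hfc.continuousAt (hΩ.mem_nhds hy)).add (-L).continuous.continuousAt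
      · filter_upwards [hΩ.mem_nhds hy] with z hz
        simp [hz]
    have := tendsto_moll_of_continuousAt hi.aestronglyMeasurable hca
    rwa [Set.indicator_of_mem hy] at this
  filter_upwards [Metric.ball_mem_nhds x (half_pos hR)] with y hy
  have hxb := Metric.mem_ball_self (x := x) (half_pos hR)
  have hsub : Metric.ball x (R / 2) ⊆ Ω := fun z hz =>
    (hball (Metric.ball_subset_ball (by linarith) hz)).2
  have := abs_sub_le_of_weakPartial_bound hη0.le hR hi hw (fun z hz => (hball hz).2)
    (fun i => Eventually.of_forall fun z hz => by
      have := (hball hz).1 i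
      rw [← sub_eq_add_neg]
      exact this.le) hy hxb (hc₁ y (hsub hy)) (hc₁ x hx)
  rw [Real.norm_eq_abs]
  calc |f y - f x - L (y - x)| = |f₁ y - f₁ x| := by
        congr 1
        simp only [hf₁, map_sub, neg_apply]
        ring
    _ ≤ n * η * ‖y - x‖ := this
    _ ≤ c * ‖y - x‖ := by gcongr

/-! ### Matrix fields -/

section Matrices

variable {A : MatField n} {k : ℕ∞ω}

theorem contDiffOn_det (h : ∀ i j, ContDiffOn ℝ k (fun x => A x i j) Ω) :
    ContDiffOn ℝ k (fun x => (A x).det) Ω := by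
  simp only [Matrix.det_apply]
  exact ContDiffOn.sum fun σ _ => (contDiffOn_prod fun i _ => h _ _).const_smul _

theorem locBdd_det (h : ∀ i j, LocBdd Ω (fun x => A x i j)) :
    LocBdd Ω (fun x => (A x).det) := by
  simp only [Matrix.det_apply']
  exact LocBdd.sum _ fun σ _ => (locBdd_const _).mul (LocBdd.prod _ fun i _ => h _ _)

theorem contDiffOn_adjugate (h : ∀ i j, ContDiffOn ℝ k (fun x => A x i j) Ω) (i j : Fin n) :
    ContDiffOn ℝ k (fun x => (A x).adjugate i j) Ω := by
  simp only [Matrix.adjugate_apply]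
  refine contDiffOn_det fun a b => ?_
  simp only [Matrix.updateRow_apply]
  split_ifs
  · exact contDiffOn_const
  · exact h a b

theorem inv_entry (B : Matrix (Fin n) (Fin n) ℝ) (i j : Fin n) :
    B⁻¹ i j = B.det⁻¹ * B.adjugate i j := by
  simp [Matrix.inv_def]

theorem contDiffOn_inv_entry (h : ∀ i j, ContDiffOn ℝ k (fun x => A x i j) Ω)
    (hu : ∀ x ∈ Ω, IsUnit (A x)) (i j : Fin n) : ContDiffOn ℝ k (fun x => (A x)⁻¹ i j) Ω := by
  simp only [inv_entry]
  exact ((contDiffOn_det h).inv fun x hx =>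
    ((Matrix.isUnit_iff_isUnit_det _).1 (hu x hx)).ne_zero).mul (contDiffOn_adjugate h i j)

theorem IsSmoothMetricOn.isUnit (hA : IsSmoothMetricOn Ω A) {x : Eu n} (hx : x ∈ Ω) :
    IsUnit (A x) := (hA.posDef x hx).isUnit

theorem IsSmoothMetricOn.isSymm (hA : IsSmoothMetricOn Ω A) {x : Eu n} (hx : x ∈ Ω) :
    (A x).IsSymm := by
  have := (hA.posDef x hx).isHermitian
  rwa [Matrix.IsHermitian, Matrix.conjTranspose_eq_transpose_of_trivial] at this

theorem pdMat_isSymm (hΩ : IsOpen Ω) (hA : ∀ x ∈ Ω, (A x).IsSymm) {x : Eu n} (hx : x ∈ Ω)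
    (k : Fin n) : (pdMat A x k).IsSymm := by
  ext p q
  simp only [pdMat, Matrix.transpose_apply, Matrix.of_apply]
  refine pd_congr ?_
  filter_upwards [hΩ.mem_nhds hx] with y hy
  exact (hA y hy).apply p q

theorem IsSmoothMetricOn.contDiffOn_pd (hΩ : IsOpen Ω) (hA : IsSmoothMetricOn Ω A)
    (i p q : Fin n) : ContDiffOn ℝ ∞ (pd i fun y => A y p q) Ω :=
  InverseDesign.contDiffOn_pd hΩ (hA.smooth p q) (by simp)

theorem IsSmoothMetricOn.contDiffOn_inv (hA : IsSmoothMetricOn Ω A) (i j : Fin n) :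
    ContDiffOn ℝ ∞ (fun x => (A x)⁻¹ i j) Ω :=
  contDiffOn_inv_entry hA.smooth (fun _ hx => hA.isUnit hx) i j

theorem IsSmoothMetricOn.contDiffOn_christoffel (hΩ : IsOpen Ω) (hA : IsSmoothMetricOn Ω A)
    (m i j : Fin n) : ContDiffOn ℝ ∞ (christoffel A m i j) Ω :=
  contDiffOn_const.mul (ContDiffOn.sum fun k _ => (hA.contDiffOn_inv m k).mul
    (((hA.contDiffOn_pd hΩ _ _ _).add (hA.contDiffOn_pd hΩ _ _ _)).sub
      (hA.contDiffOn_pd hΩ _ _ _)))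

variable {G Gt w : MatField n}

/-- The inductive step of the bootstrap: the system expresses `∇w` with the same regularity as `w`.
-/
theorem contDiffOn_totalRHS (hΩ : IsOpen Ω) (hG : IsSmoothMetricOn Ω G)
    (hGt : IsSmoothMetricOn Ω Gt) (hk : k ≤ ∞) (hw : ∀ s i, ContDiffOn ℝ k (fun x => w x s i) Ω)
    (hu : ∀ x ∈ Ω, IsUnit (w x)) (s i j : Fin n) :
    ContDiffOn ℝ k (totalRHS G Gt w s i j) Ω := by
  have h1 : ∀ m i j, ContDiffOn ℝ k (christoffel Gt m i j) Ω := fun m i j =>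
    (hGt.contDiffOn_christoffel hΩ m i j).of_le hk
  have h2 : ∀ a p q, ContDiffOn ℝ k (pd a fun y => G y p q) Ω := fun a p q =>
    (hG.contDiffOn_pd hΩ a p q).of_le hk
  have h3 : ∀ a b, ContDiffOn ℝ k (fun x => (G x)⁻¹ a b) Ω := fun a b =>
    (hG.contDiffOn_inv a b).of_le hk
  have h4 := contDiffOn_inv_entry hw hu
  exact (ContDiffOn.sum fun m _ => (hw _ _).mul (h1 _ _ _)).sub
    (contDiffOn_const.mul (ContDiffOn.sum fun m _ => (h3 _ _).mul
      (((ContDiffOn.sum fun p _ => (hw _ _).mul (h2 _ _ _)).add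
        (ContDiffOn.sum fun p _ => (hw _ _).mul (h2 _ _ _))).sub
        (ContDiffOn.sum fun p _ => ContDiffOn.sum fun q _ => ContDiffOn.sum fun t _ =>
          (((hw _ _).mul (hw _ _)).mul (h2 _ _ _)).mul (h4 _ _)))))

theorem locBdd_totalRHS (hΩ : IsOpen Ω) (hG : IsSmoothMetricOn Ω G)
    (hGt : IsSmoothMetricOn Ω Gt) (hw : ∀ s i, LocBdd Ω (fun x => w x s i))
    (hW : ∀ s i, LocBdd Ω (fun x => (w x)⁻¹ s i)) (s i j : Fin n) :
    LocBdd Ω (totalRHS G Gt w s i j) := by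
  have h1 : ∀ m i j, LocBdd Ω (christoffel Gt m i j) := fun m i j =>
    locBdd_of_continuousOn hΩ (hGt.contDiffOn_christoffel hΩ m i j).continuousOn
  have h2 : ∀ a p q, LocBdd Ω (pd a fun y => G y p q) := fun a p q =>
    locBdd_of_continuousOn hΩ (hG.contDiffOn_pd hΩ a p q).continuousOn
  have h3 : ∀ a b, LocBdd Ω (fun x => (G x)⁻¹ a b) := fun a b =>
    locBdd_of_continuousOn hΩ (hG.contDiffOn_inv a b).continuousOn
  exact (LocBdd.sum _ fun m _ => (hw _ _).mul (h1 _ _ _)).sub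
    ((locBdd_const _).mul (LocBdd.sum _ fun m _ => (h3 _ _).mul
      (((LocBdd.sum _ fun p _ => (hw _ _).mul (h2 _ _ _)).add
        (LocBdd.sum _ fun p _ => (hw _ _).mul (h2 _ _ _))).sub
        (LocBdd.sum _ fun p _ => LocBdd.sum _ fun q _ => LocBdd.sum _ fun t _ =>
          (((hw _ _).mul (hw _ _)).mul (h2 _ _ _)).mul (hW _ _)))))

theorem exists_ae_bound_of_memLp_top {μ : Measure (Eu n)} (h : MemLp f ⊤ μ) :
    ∃ C : ℝ, ∀ᵐ x ∂μ, |f x| ≤ C := by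
  have hlt := h.2
  rw [eLpNorm_exponent_top] at hlt
  refine ⟨(eLpNormEssSup f μ).toReal, ?_⟩
  filter_upwards [ae_le_eLpNormEssSup (f := f) (μ := μ)] with x hx
  have := ENNReal.toReal_mono hlt.ne hx
  simpa using this

end Matrices

/-- A classical solution of the total differential system. -/
structure IsClassicalSolution (Ω : Set (Eu n)) (G Gt w : MatField n) : Prop where
  smooth : ∀ s i, ContDiffOn ℝ ∞ (fun x => w x s i) Ω
  isUnit : ∀ x ∈ Ω, IsUnit (w x)
  eqn : ∀ s i j, ∀ x ∈ Ω, pd j (fun y => w y s i) x = totalRHS G Gt w s i j x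

/-- Bounded distributional solutions of the total differential system are smooth. -/
theorem IsBoundedTotalSolution.exists_classical (hΩ : IsOpen Ω) {G Gt w : MatField n}
    (hG : IsSmoothMetricOn Ω G) (hGt : IsSmoothMetricOn Ω Gt)
    (h : IsBoundedTotalSolution Ω G Gt w) :
    ∃ v : MatField n, IsClassicalSolution Ω G Gt v ∧ ∀ᵐ x, x ∈ Ω → v x = w x := by
  choose C hC using fun s i => exists_ae_bound_of_memLp_top (h.bounded s i)
  choose D hD using fun s i => exists_ae_bound_of_memLp_top (h.inv_bounded s i)
  have hint : ∀ s i, LocallyIntegrable (Ω.indicator fun x => w x s i) volume := fun s i =>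
    locallyIntegrable_indicator hΩ (h.bounded s i).1 (hC s i)
  have hwb : ∀ s i, LocBdd Ω (fun x => w x s i) := fun s i => locBdd_of_ae_bound hΩ (hC s i)
  have hWb : ∀ s i, LocBdd Ω (fun x => (w x)⁻¹ s i) := fun s i => locBdd_of_ae_bound hΩ (hD s i)
  choose F hFc hF using fun s i => exists_continuousOn_ae_eq hΩ (hint s i)
    (fun j => h.total s i j) (fun j => locBdd_totalRHS hΩ hG hGt hwb hWb s i j)
  set v : MatField n := fun x => Matrix.of fun s i => F s i x with hv
  have hvw : ∀ᵐ x, x ∈ Ω → v x = w x := by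
    have : ∀ᵐ x, ∀ s i, x ∈ Ω → F s i x = w x s i :=
      ae_all_iff.2 fun s => ae_all_iff.2 fun i => hF s i
    filter_upwards [this] with x hx hxΩ
    ext s i
    exact hx s i hxΩ
  have hvc : ∀ s i, ContinuousOn (fun x => v x s i) Ω := hFc
  -- Almost everywhere `|det w| |det w⁻¹| = 1` with `det w⁻¹` locally bounded, so the continuous
  -- function `det v` is locally bounded away from zero.
  have hu : ∀ x ∈ Ω, IsUnit (v x) := by
    intro x hx
    rw [Matrix.isUnit_iff_isUnit_det, isUnit_iff_ne_zero]
    intro h0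
    obtain ⟨U, hU, M, hM⟩ := locBdd_det hWb x hx
    have hdet : ContinuousOn (fun x => (v x).det) Ω :=
      (contDiffOn_det (k := 0) fun i j => contDiffOn_zero.2 (hvc i j)).continuousOn
    have hca : ContinuousAt (fun x => |(v x).det| * |M|) x :=
      (hdet.continuousAt (hΩ.mem_nhds hx)).abs.mul continuousAt_const
    have hlt : ∀ᶠ y in 𝓝 x, |(v y).det| * |M| < 1 :=
      hca.eventually (gt_mem_nhds (by simp [h0]))
    have hae : ∀ᵐ y, y ∈ Ω → y ∈ U → 1 ≤ |(v y).det| * |M| := by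
      filter_upwards [hvw, hM, ae_imp_of_ae_restrict hΩ h.invertible] with y h1 h2 h3 hy hyU
      rw [h1 hy]
      have hd : (w y).det * ((w y)⁻¹).det = 1 := by
        rw [← Matrix.det_mul, Matrix.mul_nonsing_inv _
          ((Matrix.isUnit_iff_isUnit_det _).1 (h3 hy)), Matrix.det_one]
      calc (1 : ℝ) = |(w y).det| * |((w y)⁻¹).det| := by rw [← abs_mul, hd, abs_one]
        _ ≤ _ := mul_le_mul_of_nonneg_left ((h2 hyU).trans (le_abs_self M)) (abs_nonneg _)
    obtain ⟨y, hy, hy'⟩ := exists_mem_of_ae hae (inter_mem hlt (inter_mem (hΩ.mem_nhds hx) hU))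
    exact absurd (hy' hy.2.1 hy.2.2) (not_le.2 hy.1)
  have hae : ∀ᵐ x ∂(volume.restrict Ω), v x = w x :=
    (ae_restrict_iff' hΩ.measurableSet).2 hvw
  have hweak : ∀ s i j, HasWeakPartial Ω j (fun x => v x s i) (totalRHS G Gt v s i j) :=
    fun s i j => (h.total s i j).congr hΩ (hae.mono fun x hx => by simp only [hx])
      (hae.mono fun x hx => by simp only [totalRHS, hx])
  have hint' : ∀ s i, LocallyIntegrable (Ω.indicator fun x => v x s i) volume := fun s i =>
    (hint s i).congr (by
      filter_upwards [hvw] with x hx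
      by_cases hxΩ : x ∈ Ω
      · simp [hxΩ, hx hxΩ]
      · simp [hxΩ])
  -- Since `v` is continuous and invertible everywhere, the right side is continuous and the weak
  -- equation becomes classical.
  have hder : ∀ s i, ∀ x ∈ Ω, HasFDerivAt (fun x => v x s i)
      (linForm fun j => totalRHS G Gt v s i j x) x := fun s i x hx =>
    hasFDerivAt_of_weakPartial hΩ (hint' s i) (hvc s i) (hweak s i) (fun j =>
      (contDiffOn_totalRHS (k := 0) hΩ hG hGt (by simp)
        (fun a b => contDiffOn_zero.2 (hvc a b)) hu s i j).continuousOn) hx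
  have hk : ∀ k : ℕ, ∀ s i, ContDiffOn ℝ k (fun x => v x s i) Ω := by
    intro k
    induction k with
    | zero => exact fun s i => contDiffOn_zero.2 (hvc s i)
    | succ k ih =>
      intro s i
      have hcast : ((k + 1 : ℕ) : ℕ∞ω) = (k : ℕ∞ω) + 1 := by norm_cast
      rw [hcast, contDiffOn_succ_iff_fderiv_of_isOpen hΩ]
      refine ⟨fun x hx => (hder s i x hx).differentiableAt.differentiableWithinAt,
        by simp, ?_⟩
      have : ContDiffOn ℝ k (fun x => linForm fun j => totalRHS G Gt v s i j x) Ω := by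
        unfold linForm
        exact ContDiffOn.sum fun j _ => (contDiffOn_totalRHS hΩ hG hGt
          (by exact_mod_cast le_top) ih hu s i j).smul contDiffOn_const
      exact this.congr fun x hx => (hder s i x hx).fderiv
  refine ⟨v, ⟨fun s i => contDiffOn_infty.2 fun k => hk k s i, hu, fun s i j x hx => ?_⟩, hvw⟩
  rw [pd, (hder s i x hx).fderiv, linForm_basisVec]

end InverseDesign

namespace InverseDesign

open Filter Topology

variable {n : ℕ} {Ω : Set (Eu n)} {G Gt w v : MatField n} {ξ ζ : Eu n → Eu n}

/-! ### Potentials of classical solutions -/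

/-- This symmetry is the closedness of the rows of `w`: every classical solution of the system is
locally a gradient, with no further condition. -/
theorem totalRHS_symm (hΩ : IsOpen Ω) (hG : IsSmoothMetricOn Ω G) (hGt : IsSmoothMetricOn Ω Gt)
    (s i j : Fin n) {x : Eu n} (hx : x ∈ Ω) :
    totalRHS G Gt w s i j x = totalRHS G Gt w s j i x := by
  rw [totalRHS_eq, totalRHS_eq, corr_symm (pdMat_isSymm hΩ (fun _ hy => hG.isSymm hy) hx)]
  simp_rw [chr_symm (pdMat_isSymm hΩ (fun _ hy => hGt.isSymm hy) hx) _ _ i j]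

theorem pd_sum {ι : Type*} (s : Finset ι) {F : ι → Eu n → ℝ} {x : Eu n} {i : Fin n}
    (h : ∀ a ∈ s, DifferentiableAt ℝ (F a) x) :
    pd i (fun y => ∑ a ∈ s, F a y) x = ∑ a ∈ s, pd i (F a) x := by
  simp only [pd]
  rw [fderiv_fun_sum h]
  simp

theorem fderiv_coord {x : Eu n} (h : DifferentiableAt ℝ ξ x) (t : Fin n) :
    fderiv ℝ (fun y => ξ y t) x = (EuclideanSpace.proj t).comp (fderiv ℝ ξ x) :=
  ((EuclideanSpace.proj (𝕜 := ℝ) t).hasFDerivAt.comp x h.hasFDerivAt).fderiv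

theorem jac_apply {x : Eu n} (h : DifferentiableAt ℝ ξ x) (t i : Fin n) :
    jac ξ x t i = pd i (fun y => ξ y t) x := by
  rw [pd, fderiv_coord h]
  rfl

theorem fderiv_apply_eq_mulVec (x u : Eu n) (t : Fin n) :
    fderiv ℝ ξ x u t = (jac ξ x *ᵥ u) t := by
  have := clm_apply_eq_sum ((EuclideanSpace.proj (𝕜 := ℝ) t).comp (fderiv ℝ ξ x)) u
  refine this.trans ?_
  simp [Matrix.mulVec, dotProduct, jac, mul_comm]

theorem contDiffOn_jac (hΩ : IsOpen Ω) (h : ContDiffOn ℝ ∞ ξ Ω) (t i : Fin n) :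
    ContDiffOn ℝ ∞ (fun x => jac ξ x t i) Ω := by
  have h1 : ContDiffOn ℝ ∞ (fun x => fderiv ℝ ξ x (basisVec i)) Ω :=
    (h.fderiv_of_isOpen hΩ (m := ∞) (by simp)).clm_apply contDiffOn_const
  exact (EuclideanSpace.proj (𝕜 := ℝ) t).contDiff.comp_contDiffOn h1

/-- A classical solution of the total differential system is a gradient. -/
theorem IsClassicalSolution.exists_potential (hΩ : IsOpen Ω) (hsc : IsSimplyConnected Ω)
    (hG : IsSmoothMetricOn Ω G) (hGt : IsSmoothMetricOn Ω Gt) (hv : IsClassicalSolution Ω G Gt v) :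
    ∃ ξ : Eu n → Eu n, ContDiffOn ℝ ∞ ξ Ω ∧ ∀ x ∈ Ω, jac ξ x = v x := by
  have hdiff : ∀ t i, ∀ x ∈ Ω, DifferentiableAt ℝ (fun x => v x t i) x := fun t i x hx =>
    ((hv.smooth t i).contDiffAt (hΩ.mem_nhds hx)).differentiableAt (by simp)
  have hlin : ∀ t, ContDiffOn ℝ ∞ (fun x => linForm fun i => v x t i) Ω := fun t =>
    ContDiffOn.sum fun i _ => (hv.smooth t i).smul contDiffOn_const
  have hprim : ∀ t, ∃ f : Eu n → ℝ, ∀ a ∈ Ω, HasFDerivAt f (linForm fun i => v a t i) a := by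
    intro t
    refine exists_primitive_of_isSimplyConnected hΩ hsc fun x hx => ?_
    obtain ⟨r, hr, hball⟩ := Metric.mem_nhds_iff.1 (hΩ.mem_nhds hx)
    -- Poincaré lemma on a ball; the required symmetry of the derivative of the one-form is
    -- `totalRHS_symm`.
    refine ⟨r, hr, (convex_ball x r).exists_forall_hasFDerivAt_of_fderiv_symmetric
      Metric.isOpen_ball (((hlin t).differentiableOn (by simp)).mono hball) fun a ha y z => ?_⟩
    have haΩ := hball ha
    have hfd : ∀ y z : Eu n, fderiv ℝ (fun x => linForm fun i => v x t i) a y z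
        = ∑ i, ∑ j, y j * totalRHS G Gt v t i j a * z i := fun y z => by
      have hd : HasFDerivAt (fun x => linForm fun i => v x t i)
          (∑ i, (fderiv ℝ (fun x => v x t i) a).smulRight
            (EuclideanSpace.proj i : Eu n →L[ℝ] ℝ)) a :=
        HasFDerivAt.fun_sum fun i _ => (hdiff t i a haΩ).hasFDerivAt.smul_const
          (EuclideanSpace.proj i : Eu n →L[ℝ] ℝ)
      rw [hd.fderiv]
      simp only [sum_apply, ContinuousLinearMap.smulRight_apply,
        smul_apply, PiLp.proj_apply, smul_eq_mul]
      refine Finset.sum_congr rfl fun i _ => ?_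
      rw [clm_apply_eq_sum, Finset.sum_mul]
      refine Finset.sum_congr rfl fun j _ => ?_
      rw [← hv.eqn t i j a haΩ]
      rfl
    rw [hfd, hfd, Finset.sum_comm]
    refine Finset.sum_congr rfl fun i _ => Finset.sum_congr rfl fun j _ => ?_
    rw [totalRHS_symm hΩ hG hGt t j i haΩ]
    ring
  choose f hf using hprim
  have hsm : ContDiffOn ℝ ∞ (fun x => (WithLp.toLp 2 fun t => f t x : Eu n)) Ω := by
    rw [contDiffOn_euclidean]
    intro t
    refine (contDiffOn_infty_iff_fderiv_of_isOpen hΩ).2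
      ⟨fun x hx => (hf t x hx).differentiableAt.differentiableWithinAt, ?_⟩
    exact (hlin t).congr fun x hx => (hf t x hx).fderiv
  refine ⟨_, hsm, fun x hx => ?_⟩
  ext t i
  rw [jac_apply ((hsm.contDiffAt (hΩ.mem_nhds hx)).differentiableAt (by simp))]
  change pd i (f t) x = v x t i
  rw [pd, (hf t x hx).fderiv, linForm_basisVec]

theorem IsClassicalSolution.congr (hΩ : IsOpen Ω) (hv : IsClassicalSolution Ω G Gt v)
    (h : ∀ x ∈ Ω, w x = v x) : IsClassicalSolution Ω G Gt w where
  smooth s i := (hv.smooth s i).congr fun x hx => by rw [h x hx]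
  isUnit x hx := h x hx ▸ hv.isUnit x hx
  eqn s i j x hx := by
    have h1 : pd j (fun y => w y s i) x = pd j (fun y => v y s i) x := pd_congr (by
      filter_upwards [hΩ.mem_nhds hx] with y hy
      rw [h y hy])
    rw [h1, hv.eqn s i j x hx]
    simp only [totalRHS, h x hx]

/-- The gradient of every smooth potential is a classical solution. -/
theorem IsSmoothPotential.isClassicalSolution (hΩ : IsOpen Ω)
    (hv : IsClassicalSolution Ω G Gt v) (hvw : ∀ᵐ x, x ∈ Ω → v x = w x)
    (h : IsSmoothPotential Ω w ξ) : IsClassicalSolution Ω G Gt (jac ξ) := by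
  refine hv.congr hΩ fun x hx => ?_
  ext s i
  have hae : (fun x => jac ξ x s i) =ᵐ[volume.restrict Ω] fun x => v x s i := by
    filter_upwards [h.2, (ae_restrict_iff' hΩ.measurableSet).2 hvw] with y h1 h2
    rw [h2, h1]
  exact Measure.eqOn_open_of_ae_eq hae hΩ (contDiffOn_jac hΩ h.1 s i).continuousOn
    (hv.smooth s i).continuousOn hx

/-! ### Local inverses -/

/-- The derivative of `ξ` as a linear equivalence. -/
theorem exists_equiv_of_isUnit_jac {x : Eu n} (h : IsUnit (jac ξ x)) :
    ∃ e : Eu n ≃L[ℝ] Eu n, (e : Eu n →L[ℝ] Eu n) = fderiv ℝ ξ x := by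
  have hinj : Function.Injective (fderiv ℝ ξ x).toLinearMap := by
    rw [← LinearMap.ker_eq_bot, LinearMap.ker_eq_bot']
    intro u hu
    have h1 : jac ξ x *ᵥ (u : Fin n → ℝ) = 0 := by
      ext t
      rw [← fderiv_apply_eq_mulVec]
      have : fderiv ℝ ξ x u = 0 := hu
      rw [this]
      rfl
    have h2 : (u : Fin n → ℝ) = 0 := by
      have := congrArg (fun z => (jac ξ x)⁻¹ *ᵥ z) h1
      simpa [Matrix.mulVec_mulVec, Matrix.nonsing_inv_mul _
        ((Matrix.isUnit_iff_isUnit_det _).1 h)] using this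
    ext t
    exact congrFun h2 t
  refine ⟨(LinearEquiv.ofInjectiveEndo _ hinj).toContinuousLinearEquiv, ?_⟩
  ext u
  rfl

variable (hΩ : IsOpen Ω) (hξ : ContDiffOn ℝ ∞ ξ Ω) (hu : ∀ x ∈ Ω, IsUnit (jac ξ x))
include hΩ hξ hu

theorem exists_injOn_nhds {x : Eu n} (hx : x ∈ Ω) :
    ∃ V : Set (Eu n), IsOpen V ∧ x ∈ V ∧ V ⊆ Ω ∧ Set.InjOn ξ V := by
  obtain ⟨e, he⟩ := exists_equiv_of_isUnit_jac (hu x hx)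
  have hc := hξ.contDiffAt (hΩ.mem_nhds hx)
  have hd : HasFDerivAt ξ (e : Eu n →L[ℝ] Eu n) x :=
    he ▸ (hc.differentiableAt (by simp)).hasFDerivAt
  let φ := hc.toOpenPartialHomeomorph ξ hd (by simp)
  refine ⟨φ.source ∩ Ω, φ.open_source.inter hΩ,
    ⟨hc.mem_toOpenPartialHomeomorph_source hd (by simp), hx⟩, Set.inter_subset_right, ?_⟩
  have hφ : Set.InjOn ξ φ.source := φ.injOn
  exact hφ.mono Set.inter_subset_left

/-- Near each `ξ x`, the inverse supplied by the inverse function theorem takes values in `V`. There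
any left inverse `ζ` of `ξ` on `V` must coincide with it, so smoothness is inherited. -/
theorem isOpen_image_and_contDiffOn {V : Set (Eu n)} (hV : IsOpen V) (hVΩ : V ⊆ Ω)
    (hζ : Set.LeftInvOn ζ ξ V) : IsOpen (ξ '' V) ∧ ContDiffOn ℝ ∞ ζ (ξ '' V) := by
  have main : ∀ x ∈ V, ξ '' V ∈ 𝓝 (ξ x) ∧ ContDiffAt ℝ ∞ ζ (ξ x) := by
    intro x hxV
    have hx := hVΩ hxV
    obtain ⟨e, he⟩ := exists_equiv_of_isUnit_jac (hu x hx)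
    have hc := hξ.contDiffAt (hΩ.mem_nhds hx)
    have hd : HasFDerivAt ξ (e : Eu n →L[ℝ] Eu n) x :=
      he ▸ (hc.differentiableAt (by simp)).hasFDerivAt
    have hs : HasStrictFDerivAt ξ (e : Eu n →L[ℝ] Eu n) x := hc.hasStrictFDerivAt' hd (by simp)
    have himg : ξ '' V ∈ 𝓝 (ξ x) := by
      rw [← hs.map_nhds_eq_of_equiv]
      exact image_mem_map (hV.mem_nhds hxV)
    refine ⟨himg, ?_⟩
    let φ := hc.toOpenPartialHomeomorph ξ hd (by simp)
    have hxs : x ∈ φ.source := hc.mem_toOpenPartialHomeomorph_source hd (by simp)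
    have hinv : ContDiffAt ℝ ∞ φ.symm (φ x) := hc.to_localInverse hd (by simp)
    have hcont : ContinuousAt φ.symm (φ x) := φ.continuousAt_symm (φ.map_source hxs)
    refine hinv.congr_of_eventuallyEq ?_
    have hVn : ∀ᶠ z in 𝓝 (φ x), φ.symm z ∈ V :=
      hcont.eventually (by rw [φ.left_inv hxs]; exact hV.mem_nhds hxV)
    filter_upwards [hVn, φ.open_target.mem_nhds (φ.map_source hxs)] with z hz hzt
    have h1 : ξ (φ.symm z) = z := φ.right_inv hzt
    rw [← hζ hz, h1]
  refine ⟨isOpen_iff_mem_nhds.2 ?_, ?_⟩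
  · rintro _ ⟨x, hx, rfl⟩
    exact (main x hx).1
  · rintro _ ⟨x, hx, rfl⟩
    exact (main x hx).2.contDiffWithinAt

end InverseDesign

namespace InverseDesign

open Filter Topology

variable {n : ℕ} {Ω : Set (Eu n)} {G Gt w v : MatField n} {ξ ζ : Eu n → Eu n}

/-! ### Transformation of Christoffel symbols -/

theorem pull_apply (w g : Matrix (Fin n) (Fin n) ℝ) (i j : Fin n) :
    (wᵀ * g * w) i j = ∑ s, ∑ t, w s i * g s t * w t j := by
  simp only [Matrix.mul_apply, Finset.sum_mul, Matrix.transpose_apply]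
  rw [Finset.sum_comm]

theorem pd_pull {B W : MatField n} {x : Eu n}
    (hB : ∀ p q, DifferentiableAt ℝ (fun y => B y p q) x)
    (hW : ∀ p q, DifferentiableAt ℝ (fun y => W y p q) x) (k i j : Fin n) :
    pd k (fun y => ((W y)ᵀ * B y * W y) i j) x
      = dPull (B x) (W x) (pdMat B x) (fun s i k => pd k (fun y => W y s i) x) k i j := by
  simp only [pull_apply]
  rw [pd_sum _ fun s _ => DifferentiableAt.fun_sum fun t _ => ((hW s i).fun_mul (hB s t)).fun_mul (hW t j)]
  simp only [dPull, ← Finset.sum_add_distrib]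
  refine Finset.sum_congr rfl fun s _ => ?_
  rw [pd_sum _ fun t _ => ((hW s i).fun_mul (hB s t)).fun_mul (hW t j)]
  refine Finset.sum_congr rfl fun t _ => ?_
  rw [pd_mul ((hW s i).fun_mul (hB s t)) (hW t j), pd_mul (hW s i) (hB s t)]
  simp only [pdMat, Matrix.of_apply]
  ring

theorem pd_comp {a : Eu n → ℝ} {x : Eu n} (ha : DifferentiableAt ℝ a (ξ x))
    (hξ : DifferentiableAt ℝ ξ x) (k : Fin n) :
    pd k (fun y => a (ξ y)) x = ∑ r, jac ξ x r k * pd r a (ξ x) := by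
  have h := (ha.hasFDerivAt.comp x hξ.hasFDerivAt).fderiv
  have h1 : pd k (fun y => a (ξ y)) x = _ := congrArg (fun L => L (basisVec k)) h
  rw [h1, ContinuousLinearMap.comp_apply, clm_apply_eq_sum]
  rfl

theorem corr_comp {a : MatField n} {x : Eu n}
    (ha : ∀ p q, DifferentiableAt ℝ (fun z => a z p q) (ξ x)) (hξ : DifferentiableAt ℝ ξ x)
    (hs : ∀ k, (pdMat a (ξ x) k).IsSymm) (hu : IsUnit (jac ξ x))
    (gi : Matrix (Fin n) (Fin n) ℝ) (s i j : Fin n) :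
    corr gi (pdMat (fun y => a (ξ y)) x) (jac ξ x) s i j
      = ∑ p, ∑ r, jac ξ x p i * jac ξ x r j * chr gi (pdMat a (ξ x)) s p r :=
  corr_eq_chr hu hs (fun k p q => pd_comp (ha p q) hξ k) gi s i j

theorem jac_congr {x : Eu n} (h : ξ =ᶠ[𝓝 x] ζ) : jac ξ x = jac ζ x := by
  simp only [jac, h.fderiv_eq]

theorem jac_id (x : Eu n) : jac id x = 1 := by
  ext t i
  simp [jac, basisVec, Matrix.one_apply]

theorem jac_comp {x : Eu n} (hζ : DifferentiableAt ℝ ζ (ξ x)) (hξ : DifferentiableAt ℝ ξ x) :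
    jac (fun y => ζ (ξ y)) x = jac ζ (ξ x) * jac ξ x := by
  ext t i
  have h := (hζ.hasFDerivAt.comp x hξ.hasFDerivAt).fderiv
  have h1 : jac (fun y => ζ (ξ y)) x t i = _ := congrArg (fun L => L (basisVec i) t) h
  rw [h1, ContinuousLinearMap.comp_apply, fderiv_apply_eq_mulVec]
  rfl

theorem eq_zero_of_pull_eq_zero {w X : Matrix (Fin n) (Fin n) ℝ} (hw : IsUnit w)
    (h : wᵀ * X * w = 0) : X = 0 := by
  have h1 : wᵀ * X = 0 := hw.mul_left_eq_zero.1 h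
  exact ((Matrix.isUnit_transpose w).2 hw).mul_right_eq_zero.1 h1

/-- If two metrics on the image of `ξ` pull back to fields which give the same correction term,
their Christoffel symbols agree. -/
theorem christoffel_eq_of_corr_eq {a b : MatField n} {x : Eu n}
    (ha : ∀ p q, DifferentiableAt ℝ (fun z => a z p q) (ξ x))
    (hb : ∀ p q, DifferentiableAt ℝ (fun z => b z p q) (ξ x)) (hξ : DifferentiableAt ℝ ξ x)
    (has : ∀ k, (pdMat a (ξ x) k).IsSymm) (hbs : ∀ k, (pdMat b (ξ x) k).IsSymm)
    (hu : IsUnit (jac ξ x))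
    (h : ∀ s i j, corr (a (ξ x))⁻¹ (pdMat (fun y => a (ξ y)) x) (jac ξ x) s i j
      = corr (b (ξ x))⁻¹ (pdMat (fun y => b (ξ y)) x) (jac ξ x) s i j) (s k l : Fin n) :
    christoffel a s k l (ξ x) = christoffel b s k l (ξ x) := by
  have hX : (jac ξ x)ᵀ * (Matrix.of fun p r => christoffel a s p r (ξ x)
      - christoffel b s p r (ξ x)) * jac ξ x = 0 := by
    ext i j
    have h1 := h s i j
    rw [corr_comp ha hξ has hu, corr_comp hb hξ hbs hu] at h1
    rw [pull_apply]
    simp only [Matrix.of_apply, christoffel_eq_chr, Matrix.zero_apply]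
    rw [← sub_eq_zero] at h1
    rw [← h1]
    simp only [← Finset.sum_sub_distrib]
    exact Finset.sum_congr rfl fun p _ => Finset.sum_congr rfl fun r _ => by ring
  have h0 := congrFun (congrFun (eq_zero_of_pull_eq_zero hu hX) k) l
  exact sub_eq_zero.1 h0

theorem IsClassicalSolution.hess_symm (hΩ : IsOpen Ω) (hG : IsSmoothMetricOn Ω G)
    (hGt : IsSmoothMetricOn Ω Gt) (hw : IsClassicalSolution Ω G Gt w) {x : Eu n} (hx : x ∈ Ω)
    (s i j : Fin n) : pd j (fun y => w y s i) x = pd i (fun y => w y s j) x := by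
  rw [hw.eqn s i j x hx, hw.eqn s j i x hx, totalRHS_symm hΩ hG hGt s i j hx]

/-- The metrics `G ∘ ζ` and `(∇ζ)ᵀ (G̃ ∘ ζ) ∇ζ` have the same Christoffel symbols. -/
theorem christoffel_transported_eq (hΩ : IsOpen Ω) (hG : IsSmoothMetricOn Ω G)
    (hGt : IsSmoothMetricOn Ω Gt) (hξ : ContDiffOn ℝ ∞ ξ Ω)
    (hcl : IsClassicalSolution Ω G Gt (jac ξ)) {V : Set (Eu n)} (hV : IsOpen V) (hVΩ : V ⊆ Ω)
    (hζ : Set.LeftInvOn ζ ξ V) {y : Eu n} (hy : y ∈ ξ '' V) (s k l : Fin n) :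
    christoffel (transported G ζ) s k l y = christoffel (pulledBack Gt ζ) s k l y := by
  obtain ⟨hU, hζs⟩ := isOpen_image_and_contDiffOn hΩ hξ hcl.isUnit hV hVΩ hζ
  obtain ⟨x, hxV, rfl⟩ := hy
  have hx := hVΩ hxV
  have hmaps : Set.MapsTo ζ (ξ '' V) Ω := by
    rintro _ ⟨z, hz, rfl⟩
    rw [hζ hz]
    exact hVΩ hz
  have hξd : ∀ z ∈ V, DifferentiableAt ℝ ξ z := fun z hz =>
    (hξ.contDiffAt (hΩ.mem_nhds (hVΩ hz))).differentiableAt (by simp)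
  have hζd : ∀ z ∈ V, DifferentiableAt ℝ ζ (ξ z) := fun z hz =>
    (hζs.contDiffAt (hU.mem_nhds ⟨z, hz, rfl⟩)).differentiableAt (by simp)
  have hyU : ξ x ∈ ξ '' V := ⟨x, hxV, rfl⟩
  have hdiff : ∀ {f : Eu n → ℝ}, ContDiffOn ℝ ∞ f (ξ '' V) → DifferentiableAt ℝ f (ξ x) :=
    fun hf => (hf.contDiffAt (hU.mem_nhds hyU)).differentiableAt (by simp)
  have hinv : ∀ z ∈ V, jac ζ (ξ z) * jac ξ z = 1 := fun z hz => by
    rw [← jac_comp (hζd z hz) (hξd z hz), ← jac_id z]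
    refine jac_congr ?_
    filter_upwards [hV.mem_nhds hz] with t ht
    exact hζ ht
  have has : ∀ p q, ContDiffOn ℝ ∞ (fun z => transported G ζ z p q) (ξ '' V) := fun p q =>
    (hG.smooth p q).comp hζs hmaps
  have hts : ∀ p q, ContDiffOn ℝ ∞ (fun z => Gt (ζ z) p q) (ξ '' V) := fun p q =>
    (hGt.smooth p q).comp hζs hmaps
  have hjs := contDiffOn_jac hU hζs
  have hbs : ∀ p q, ContDiffOn ℝ ∞ (fun z => pulledBack Gt ζ z p q) (ξ '' V) := fun p q => by
    simp only [pulledBack, pull_apply]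
    exact ContDiffOn.sum fun s _ => ContDiffOn.sum fun t _ =>
      ((hjs s p).mul (hts s t)).mul (hjs t q)
  have hbsymm : ∀ z ∈ ξ '' V, (pulledBack Gt ζ z).IsSymm := fun z hz => by
    have := (hGt.isSymm (hmaps hz)).eq
    simp only [Matrix.IsSymm, pulledBack, Matrix.transpose_mul, Matrix.transpose_transpose, this,
      Matrix.mul_assoc]
  -- Pulling `𝒢̃` back by `ξ` recovers `G̃`, so `(∇ξ, 𝒢̃ ∘ ξ, G̃)` satisfies the algebraic
  -- constraint on `V`.
  have hpull : ∀ z ∈ V, Gt z = (jac ξ z)ᵀ * pulledBack Gt ζ (ξ z) * jac ξ z := fun z hz => by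
    have : (jac ξ z)ᵀ * pulledBack Gt ζ (ξ z) * jac ξ z
        = (jac ζ (ξ z) * jac ξ z)ᵀ * Gt z * (jac ζ (ξ z) * jac ξ z) := by
      simp only [pulledBack, hζ hz, Matrix.transpose_mul, Matrix.mul_assoc]
    rw [this, hinv z hz]
    simp
  have hwu := hcl.isUnit x hx
  have hζu : IsUnit (jac ζ (ξ x)) := IsUnit.of_mul_eq_one _ (hinv x hxV)
  have hbu : IsUnit (pulledBack Gt ζ (ξ x)) :=
    (((Matrix.isUnit_transpose _).2 hζu).mul (hGt.isUnit (hmaps hyU))).mul hζu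
  have hbcomp : ∀ p q, DifferentiableAt ℝ (fun z => pulledBack Gt ζ (ξ z) p q) x := fun p q =>
    (hdiff (hbs p q)).comp x (hξd x hxV)
  have hjd : ∀ p q, DifferentiableAt ℝ (fun z => jac ξ z p q) x := fun p q =>
    ((hcl.smooth p q).contDiffAt (hΩ.mem_nhds hx)).differentiableAt (by simp)
  refine christoffel_eq_of_corr_eq (fun p q => hdiff (has p q)) (fun p q => hdiff (hbs p q))
    (hξd x hxV) (pdMat_isSymm hU (fun z hz => hG.isSymm (hmaps hz)) hyU)
    (pdMat_isSymm hU hbsymm hyU) hwu (fun s i j => ?_) s k l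
  have hA : pdMat (fun z => transported G ζ (ξ z)) x = pdMat G x := by
    ext k p q
    refine pd_congr ?_
    filter_upwards [hV.mem_nhds hxV] with z hz
    simp only [transported, hζ hz]
  have hdt : ∀ k i j, pdMat Gt x k i j = dPull (pulledBack Gt ζ (ξ x)) (jac ξ x)
      (pdMat (fun z => pulledBack Gt ζ (ξ z)) x)
      (fun s i k => pd k (fun z => jac ξ z s i) x) k i j := fun k i j => by
    rw [← pd_pull hbcomp hjd]
    refine pd_congr ?_
    filter_upwards [hV.mem_nhds hxV] with z hz
    rw [← hpull z hz]
  -- Two formulas for the same `∂ⱼwᵢ` with the same `Γ̃` term: one from the constraint with `𝒢̃`,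
  -- one from the system with `G`. Their correction terms must agree.
  have e1 := eq_total_of_pull hbu hwu (hbsymm _ hyU)
    (pdMat_isSymm hV (fun z hz => hbsymm _ ⟨z, hz, rfl⟩) hxV)
    (fun s i j => hcl.hess_symm hΩ hG hGt hx s i j) (hpull x hxV) hdt s i j
  have e2 := hcl.eqn s i j x hx
  rw [totalRHS_eq] at e2
  rw [hA]
  simp only [transported, hζ hxV]
  linarith

/-! ### Propagation of the algebraic constraint -/

/-- A function whose derivative is locally controlled by its value vanishes identically on a
connected open set as soon as it vanishes at one point. -/
theorem eqOn_zero_of_norm_fderiv_le {E F : Type*} [NormedAddCommGroup E] [NormedSpace ℝ E]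
    [NormedAddCommGroup F] [NormedSpace ℝ F] {Ω : Set E} (hΩ : IsOpen Ω)
    (hc : IsPreconnected Ω) {f : E → F} (hf : DifferentiableOn ℝ f Ω)
    (h : ∀ x ∈ Ω, ∃ U ∈ 𝓝 x, ∃ C : ℝ, ∀ y ∈ U, ‖fderiv ℝ f y‖ ≤ C * ‖f y‖) {x₀ : E}
    (hx₀ : x₀ ∈ Ω) (h0 : f x₀ = 0) : ∀ x ∈ Ω, f x = 0 := by
  -- The zero set is open: along the segment from a zero `z` to a nearby `x`, Grönwall's inequality
  -- with zero initial value and zero forcing gives `f x = 0`.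
  have hloc : ∀ z ∈ Ω, f z = 0 → ∀ᶠ x in 𝓝 z, f x = 0 := by
    intro z hz hz0
    obtain ⟨U, hU, C, hC⟩ := h z hz
    obtain ⟨R, hR, hball⟩ := Metric.mem_nhds_iff.1 (inter_mem hU (hΩ.mem_nhds hz))
    filter_upwards [Metric.ball_mem_nhds z hR] with x hx
    set γ : ℝ → E := fun t => z + t • (x - z) with hγ
    have hγb : ∀ t ∈ Set.Icc (0 : ℝ) 1, γ t ∈ Metric.ball z R := fun t ht => by
      have := (convex_ball z R).add_smul_sub_mem (Metric.mem_ball_self hR) hx ht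
      exact this
    have hγd : ∀ t, HasDerivAt γ (x - z) t := fun t => by
      have := ((hasDerivAt_id t).smul_const (x - z)).const_add z
      rwa [one_smul] at this
    have hd : ∀ t ∈ Set.Icc (0 : ℝ) 1,
        HasDerivAt (fun t => f (γ t)) (fderiv ℝ f (γ t) (x - z)) t := fun t ht =>
      ((hf.differentiableAt (hΩ.mem_nhds (hball (hγb t ht)).2)).hasFDerivAt).comp_hasDerivAt t
        (hγd t)
    have hgr := norm_le_gronwallBound_of_norm_deriv_right_le (f := fun t => f (γ t))
      (f' := fun t => fderiv ℝ f (γ t) (x - z)) (δ := 0) (K := |C| * ‖x - z‖) (ε := 0)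
      (a := 0) (b := 1) (fun t ht => (hd t ht).continuousAt.continuousWithinAt)
      (fun t ht => (hd t ⟨ht.1, ht.2.le⟩).hasDerivWithinAt) (by simp [hγ, hz0])
      (fun t ht => by
        have h1 := hC (γ t) (hball (hγb t ⟨ht.1, ht.2.le⟩)).1
        calc ‖fderiv ℝ f (γ t) (x - z)‖ ≤ ‖fderiv ℝ f (γ t)‖ * ‖x - z‖ :=
              ContinuousLinearMap.le_opNorm _ _
          _ ≤ (|C| * ‖f (γ t)‖) * ‖x - z‖ := by
              gcongr
              exact h1.trans (mul_le_mul_of_nonneg_right (le_abs_self C) (norm_nonneg _))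
          _ = |C| * ‖x - z‖ * ‖f (γ t)‖ + 0 := by ring)
      1 (by simp)
    rw [gronwallBound_ε0_δ0] at hgr
    simpa [hγ] using hgr
  by_contra! hne
  obtain ⟨x₁, hx₁, hx₁0⟩ := hne
  have hopen₀ : IsOpen (Ω ∩ {x | f x = 0}) := isOpen_iff_mem_nhds.2 fun z hz =>
    inter_mem (hΩ.mem_nhds hz.1) (hloc z hz.1 hz.2)
  have hopen₁ : IsOpen (Ω ∩ f ⁻¹' {0}ᶜ) :=
    hf.continuousOn.isOpen_inter_preimage hΩ isOpen_compl_singleton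
  obtain ⟨z, -, hz, hz'⟩ := hc _ _ hopen₀ hopen₁ (fun x hx => by
    by_cases h : f x = 0
    · exact Or.inl ⟨hx, h⟩
    · exact Or.inr ⟨hx, h⟩) ⟨x₀, hx₀, hx₀, h0⟩ ⟨x₁, hx₁, hx₁, hx₁0⟩
  exact hz'.2 hz.2

theorem norm_fderiv_pi_le {E ι : Type*} [NormedAddCommGroup E] [NormedSpace ℝ E] [Fintype ι]
    {f : E → ι → ℝ} {y : E} (hf : ∀ p, DifferentiableAt ℝ (fun z => f z p) y) {B : ℝ} (hB : 0 ≤ B)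
    (h : ∀ p, ‖fderiv ℝ (fun z => f z p) y‖ ≤ B) : ‖fderiv ℝ f y‖ ≤ B := by
  refine ContinuousLinearMap.opNorm_le_bound _ hB fun u => ?_
  rw [pi_norm_le_iff_of_nonneg (by positivity)]
  intro p
  have hpi : fderiv ℝ f y u p = fderiv ℝ (fun z => f z p) y u := by
    rw [show f = fun z p => f z p from rfl, fderiv_pi hf]
    rfl
  rw [hpi]
  exact (ContinuousLinearMap.le_opNorm _ _).trans
    (mul_le_mul_of_nonneg_right (h p) (norm_nonneg _))

/-- Both `wᵀ G w` and `G̃` solve the linear system `∂ₖXᵢⱼ = Γ̃ᵐᵢₖ Xₘⱼ + Γ̃ᵐⱼₖ Xᵢₘ`, the first by the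
equation for `w` and the second by compatibility of a metric with its own Christoffel symbols. -/
theorem IsClassicalSolution.pd_defect (hΩ : IsOpen Ω) (hG : IsSmoothMetricOn Ω G)
    (hGt : IsSmoothMetricOn Ω Gt) (hw : IsClassicalSolution Ω G Gt w) {x : Eu n} (hx : x ∈ Ω)
    (k i j : Fin n) :
    pd k (fun y => (Gt y - (w y)ᵀ * G y * w y) i j) x
      = (∑ m, christoffel Gt m i k x * (Gt x - (w x)ᵀ * G x * w x) m j)
        + ∑ m, christoffel Gt m j k x * (Gt x - (w x)ᵀ * G x * w x) i m := by
  have hdG : ∀ p q, DifferentiableAt ℝ (fun y => G y p q) x := fun p q =>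
    ((hG.smooth p q).contDiffAt (hΩ.mem_nhds hx)).differentiableAt (by simp)
  have hdGt : ∀ p q, DifferentiableAt ℝ (fun y => Gt y p q) x := fun p q =>
    ((hGt.smooth p q).contDiffAt (hΩ.mem_nhds hx)).differentiableAt (by simp)
  have hdw : ∀ p q, DifferentiableAt ℝ (fun y => w y p q) x := fun p q =>
    ((hw.smooth p q).contDiffAt (hΩ.mem_nhds hx)).differentiableAt (by simp)
  have hsG := pdMat_isSymm hΩ (fun _ hy => hG.isSymm hy) hx
  have hsGt := pdMat_isSymm hΩ (fun _ hy => hGt.isSymm hy) hx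
  have e1 := dPull_eq_of_total (hG.isUnit hx) (hw.isUnit x hx) (hG.isSymm hx) hsG
    (H := fun s i k => pd k (fun y => w y s i) x) (Γ := fun m i j => christoffel Gt m i j x)
    (fun s i j => hw.eqn s i j x hx) k i j
  rw [← pd_pull hdG hdw] at e1
  -- Metric compatibility is the case `w = 1`, `H = 0`, in which the correction term is the
  -- Christoffel symbol itself.
  have e2 := dPull_eq_of_total (g := Gt x) (w := 1) (hGt.isUnit hx) isUnit_one (hGt.isSymm hx) hsGt
    (H := fun _ _ _ => 0) (Γ := fun m i j => christoffel Gt m i j x)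
    (fun s i j => by
      rw [corr_eq_chr (da := pdMat Gt x) isUnit_one hsGt (fun k p q => by
        simp [Matrix.one_apply])]
      simp [Matrix.one_apply, christoffel_eq_chr]) k i j
  have e3 : dPull (Gt x) 1 (pdMat Gt x) (fun _ _ _ => 0) k i j = pd k (fun y => Gt y i j) x := by
    simp [dPull, Matrix.one_apply, pdMat]
  rw [e3] at e2
  simp only [Matrix.transpose_one, one_mul, mul_one] at e2
  have hdp : DifferentiableAt ℝ (fun y => ((w y)ᵀ * G y * w y) i j) x := by
    simp only [pull_apply]
    exact DifferentiableAt.fun_sum fun s _ => DifferentiableAt.fun_sum fun t _ =>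
      ((hdw s i).mul (hdG s t)).mul (hdw t j)
  have e4 : pd k (fun y => (Gt y - (w y)ᵀ * G y * w y) i j) x
      = pd k (fun y => Gt y i j) x - pd k (fun y => ((w y)ᵀ * G y * w y) i j) x := by
    simp only [pd, Matrix.sub_apply]
    rw [fderiv_fun_sub (hdGt i j) hdp]
    rfl
  rw [e4, e1, e2]
  simp only [Matrix.sub_apply, mul_sub, Finset.sum_sub_distrib]
  ring

/-- Along a classical solution, the algebraic constraint propagates from one point. -/
theorem IsClassicalSolution.pull_eq (hΩ : IsOpen Ω) (hconn : IsPreconnected Ω)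
    (hG : IsSmoothMetricOn Ω G) (hGt : IsSmoothMetricOn Ω Gt) (hw : IsClassicalSolution Ω G Gt w)
    {x₀ : Eu n} (hx₀ : x₀ ∈ Ω) (h0 : Gt x₀ = (w x₀)ᵀ * G x₀ * w x₀) {x : Eu n} (hx : x ∈ Ω) :
    Gt x = (w x)ᵀ * G x * w x := by
  set D : MatField n := fun y => Gt y - (w y)ᵀ * G y * w y with hD
  have hDs : ∀ i j, ContDiffOn ℝ ∞ (fun y => D y i j) Ω := fun i j => by
    simp only [hD, Matrix.sub_apply, pull_apply]
    exact (hGt.smooth i j).sub (ContDiffOn.sum fun s _ => ContDiffOn.sum fun t _ =>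
      ((hw.smooth s i).mul (hG.smooth s t)).mul (hw.smooth t j))
  have hDd : ∀ y ∈ Ω, ∀ i j, DifferentiableAt ℝ (fun y => D y i j) y := fun y hy i j =>
    ((hDs i j).contDiffAt (hΩ.mem_nhds hy)).differentiableAt (by simp)
  set f : Eu n → (Fin n × Fin n → ℝ) := fun y p => D y p.1 p.2 with hf
  have hfd : ∀ y ∈ Ω, DifferentiableAt ℝ f y := fun y hy =>
    differentiableAt_pi.2 fun p => hDd y hy p.1 p.2
  have hbound : ∀ z ∈ Ω, ∃ U ∈ 𝓝 z, ∃ C : ℝ, ∀ y ∈ U, ‖fderiv ℝ f y‖ ≤ C * ‖f y‖ := by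
    intro z hz
    have hev : ∀ᶠ y in 𝓝 z, ∀ m i k, |christoffel Gt m i k y| < |christoffel Gt m i k z| + 1 :=
      Filter.eventually_all.2 fun m => Filter.eventually_all.2 fun i =>
        Filter.eventually_all.2 fun k =>
          ((hGt.contDiffOn_christoffel hΩ m i k).continuousOn.continuousAt
            (hΩ.mem_nhds hz)).abs.eventually (gt_mem_nhds (lt_add_one _))
    obtain ⟨M, hMub⟩ := (Set.finite_range fun p : Fin n × Fin n × Fin n =>
      |christoffel Gt p.1 p.2.1 p.2.2 z| + 1).bddAbove
    have hMle : ∀ m i k, |christoffel Gt m i k z| + 1 ≤ max M 0 := fun m i k =>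
      (hMub ⟨(m, i, k), rfl⟩).trans (le_max_left M 0)
    have hM0 : 0 ≤ max M 0 := le_max_right M 0
    generalize max M 0 = M at hMle hM0
    -- Each partial derivative of an entry is two sums of `n` terms bounded by `M * ‖f y‖`. The
    -- outer `n` is the loss in `norm_clm_le`.
    refine ⟨_, inter_mem hev (hΩ.mem_nhds hz), n * (n * M + n * M), fun y hy => ?_⟩
    have hyΩ := hy.2
    have hfy : ∀ i j, |D y i j| ≤ ‖f y‖ := fun i j => norm_le_pi_norm (f y) (i, j)
    have hterm : ∀ m i k a b, |christoffel Gt m i k y * D y a b| ≤ M * ‖f y‖ := fun m i k a b => by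
      rw [abs_mul]
      exact mul_le_mul ((hy.1 m i k).le.trans (hMle m i k)) (hfy a b) (abs_nonneg _) hM0
    have hB : 0 ≤ n * ((n * M + n * M) * ‖f y‖) := by positivity
    have hcomp : ∀ p : Fin n × Fin n,
        ‖fderiv ℝ (fun y => f y p) y‖ ≤ n * ((n * M + n * M) * ‖f y‖) := fun p => by
      refine norm_clm_le (by positivity) fun k => ?_
      change |pd k (fun y => D y p.1 p.2) y| ≤ _
      rw [hw.pd_defect hΩ hG hGt hyΩ k p.1 p.2]
      calc _ ≤ (∑ _m : Fin n, M * ‖f y‖) + ∑ _m : Fin n, M * ‖f y‖ :=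
            (abs_add_le _ _).trans (add_le_add
              ((Finset.abs_sum_le_sum_abs _ _).trans (Finset.sum_le_sum fun m _ =>
                hterm m _ _ _ _))
              ((Finset.abs_sum_le_sum_abs _ _).trans (Finset.sum_le_sum fun m _ =>
                hterm m _ _ _ _)))
        _ = (n * M + n * M) * ‖f y‖ := by simp; ring
    have := norm_fderiv_pi_le (f := f) (fun p => hDd y hyΩ p.1 p.2) hB hcomp
    exact this.trans (le_of_eq (by ring))
  have hz := eqOn_zero_of_norm_fderiv_le hΩ hconn
    (fun y hy => (hfd y hy).differentiableWithinAt) hbound hx₀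
    (by ext p; simp [hf, hD, ← h0]) x hx
  ext i j
  exact sub_eq_zero.1 (congrFun hz (i, j))

end InverseDesign

namespace InverseDesign

open Filter Topology

variable {n : ℕ} {Ω : Set (Eu n)} {G Gt w : MatField n} {ξ : Eu n → Eu n}

/-! ### Bilipschitz maps -/

theorem MemSobolevTwo.congr (hΩ : IsOpen Ω) {k : ℕ} {f g : Eu n → ℝ}
    (h : f =ᵐ[volume.restrict Ω] g) (hf : MemSobolevTwo Ω k f) : MemSobolevTwo Ω k g := by
  cases k with
  | zero => exact (memLp_congr_ae h).1 hf
  | succ k =>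
    refine ⟨(memLp_congr_ae h).1 hf.1, fun i => ?_⟩
    obtain ⟨p, hp, hpk⟩ := hf.2 i
    exact ⟨p, hp.congr hΩ h (ae_eq_refl _), hpk⟩

theorem _root_.LipschitzOnWith.coord {K : NNReal} (h : LipschitzOnWith K ξ Ω) (t : Fin n) :
    LipschitzOnWith K (fun x => ξ x t) Ω :=
  LipschitzOnWith.of_dist_le_mul fun x hx y hy => by
    rw [Real.dist_eq]
    refine le_trans ?_ (h.dist_le_mul x hx y hy)
    rw [dist_eq_norm]
    exact abs_apply_le_norm (ξ x - ξ y) t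

theorem ae_differentiableAt_of_lipschitzOnWith (hΩ : IsOpen Ω) {K : NNReal}
    (h : LipschitzOnWith K ξ Ω) : ∀ᵐ x ∂(volume.restrict Ω), DifferentiableAt ℝ ξ x := by
  rw [ae_restrict_iff' hΩ.measurableSet]
  filter_upwards [h.ae_differentiableWithinAt_of_mem (μ := volume)] with x hx hxΩ
  exact (hx hxΩ).differentiableAt (hΩ.mem_nhds hxΩ)

/-- The gradient of a Lipschitz map is its weak gradient. -/
theorem hasWeakPartial_jac (hΩ : IsOpen Ω) {K : NNReal} (h : LipschitzOnWith K ξ Ω)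
    (t i : Fin n) : HasWeakPartial Ω i (fun x => ξ x t) (fun x => jac ξ x t i) :=
  (hasWeakPartial_of_lipschitzOnWith hΩ (h.coord t)).congr hΩ (ae_eq_refl _) (by
    filter_upwards [ae_differentiableAt_of_lipschitzOnWith hΩ h] with x hx
    exact (jac_apply hx t i).symm)

theorem norm_basisVec (i : Fin n) : ‖basisVec i‖ = 1 := by
  simp [basisVec]

theorem abs_jac_le (hΩ : IsOpen Ω) {K : NNReal} (h : LipschitzOnWith K ξ Ω) {x : Eu n}
    (hx : x ∈ Ω) (t i : Fin n) : |jac ξ x t i| ≤ K := by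
  have h1 := norm_fderiv_le_of_lipschitzOn ℝ (hΩ.mem_nhds hx) h
  calc |jac ξ x t i| ≤ ‖fderiv ℝ ξ x (basisVec i)‖ := abs_apply_le_norm _ t
    _ ≤ ‖fderiv ℝ ξ x‖ * ‖basisVec i‖ := ContinuousLinearMap.le_opNorm _ _
    _ ≤ K := by rw [norm_basisVec, mul_one]; exact h1

/-- The lower Lipschitz bound passes to the limit in the difference quotients in direction `u`. -/
theorem norm_le_of_antilipschitz (hΩ : IsOpen Ω) {K : NNReal}
    (h : AntilipschitzWith K (Ω.domRestrict ξ)) {x : Eu n} (hx : x ∈ Ω)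
    (hd : DifferentiableAt ℝ ξ x) (u : Eu n) : ‖u‖ ≤ K * ‖fderiv ℝ ξ x u‖ := by
  have ht := (hd.hasFDerivAt.hasLineDerivAt u).tendsto_slope_zero
  refine ge_of_tendsto (ht.norm.const_mul (K : ℝ)) ?_
  have hcont : Tendsto (fun t : ℝ => x + t • u) (𝓝[≠] 0) (𝓝 x) := by
    have : ContinuousAt (fun t : ℝ => x + t • u) 0 := by fun_prop
    have h0 := this.tendsto
    simp only [zero_smul, add_zero] at h0
    exact h0.mono_left nhdsWithin_le_nhds
  filter_upwards [hcont.eventually (hΩ.mem_nhds hx), self_mem_nhdsWithin] with t htΩ ht0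
  have ht0' : 0 < ‖t‖ := norm_pos_iff.2 ht0
  have h1 := h.le_mul_dist ⟨x + t • u, htΩ⟩ ⟨x, hx⟩
  rw [Subtype.dist_eq, dist_eq_norm, dist_eq_norm] at h1
  simp only [add_sub_cancel_left, norm_smul, Set.domRestrict_apply] at h1
  rw [norm_smul, norm_inv, ← mul_assoc, mul_comm (K : ℝ), mul_assoc, ← div_eq_inv_mul,
    le_div_iff₀ ht0', mul_comm]
  exact h1

/-- The lower bound `‖u‖ ≤ K ‖∇ξ u‖` forces injectivity. Applied to a column of the inverse, which
`∇ξ` sends to a unit vector, it bounds the entries of that column. -/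
theorem isUnit_jac_and_abs_inv_le (hΩ : IsOpen Ω) {K : NNReal}
    (h : AntilipschitzWith K (Ω.domRestrict ξ)) {x : Eu n} (hx : x ∈ Ω)
    (hd : DifferentiableAt ℝ ξ x) :
    IsUnit (jac ξ x) ∧ ∀ t m, |(jac ξ x)⁻¹ t m| ≤ K := by
  have hb := norm_le_of_antilipschitz hΩ h hx hd
  have hL : ∀ u : Fin n → ℝ, fderiv ℝ ξ x (WithLp.toLp 2 u) = WithLp.toLp 2 (jac ξ x *ᵥ u) :=
    fun u => by
      ext t
      exact fderiv_apply_eq_mulVec x _ t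
  have hu : IsUnit (jac ξ x) := by
    rw [← Matrix.mulVec_injective_iff_isUnit]
    intro u v huv
    have h1 := hb (WithLp.toLp 2 (u - v))
    rw [hL, Matrix.mulVec_sub, huv, sub_self] at h1
    simp only [WithLp.toLp_zero, norm_zero, mul_zero] at h1
    have h2 : (WithLp.toLp 2 (u - v) : Eu n) = 0 := norm_le_zero_iff.1 h1
    ext t
    have := congrArg (fun z : Eu n => z t) h2
    exact sub_eq_zero.1 this
  refine ⟨hu, fun t m => ?_⟩
  have hdet := (Matrix.isUnit_iff_isUnit_det _).1 hu
  have h1 := hb (WithLp.toLp 2 ((jac ξ x)⁻¹ *ᵥ Pi.single m 1))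
  rw [hL, Matrix.mulVec_mulVec, Matrix.mul_nonsing_inv _ hdet, Matrix.one_mulVec] at h1
  have h2 : ‖(WithLp.toLp 2 (Pi.single m (1 : ℝ)) : Eu n)‖ = 1 := norm_basisVec m
  rw [h2, mul_one] at h1
  refine le_trans ?_ h1
  have h3 := abs_apply_le_norm (WithLp.toLp 2 ((jac ξ x)⁻¹ *ᵥ Pi.single m 1) : Eu n) t
  simpa using h3

theorem aemeasurable_det {μ : Measure (Eu n)} {A : MatField n}
    (h : ∀ i j, AEMeasurable (fun x => A x i j) μ) : AEMeasurable (fun x => (A x).det) μ := by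
  simp only [Matrix.det_apply']
  exact Finset.aemeasurable_fun_sum _ fun σ _ =>
    (Finset.aemeasurable_fun_prod _ fun i _ => h _ _).const_mul _

theorem aemeasurable_inv_entry {μ : Measure (Eu n)} {A : MatField n}
    (h : ∀ i j, AEMeasurable (fun x => A x i j) μ) (i j : Fin n) :
    AEMeasurable (fun x => (A x)⁻¹ i j) μ := by
  simp only [inv_entry, Matrix.adjugate_apply]
  refine (aemeasurable_det h).inv.mul (aemeasurable_det fun a b => ?_)
  simp only [Matrix.updateRow_apply]
  split_ifs
  · exact aemeasurable_const
  · exact h a b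

/-! ### The equivalence of the two problems -/

/-- The full system implies that `w` is a bounded solution of the total differential system. -/
theorem IsSystemSolution.isBoundedTotalSolution (hΩ : IsOpen Ω)
    (h : IsSystemSolution Ω G Gt ξ w) : IsBoundedTotalSolution Ω G Gt w := by
  obtain ⟨-, K, hlip, hanti⟩ := h.bilipschitz
  have hmeas : ∀ s i, AEMeasurable (fun x => w x s i) (volume.restrict Ω) := fun s i =>
    (h.total s i i).1.aestronglyMeasurable.aemeasurable
  have hae : ∀ᵐ x ∂(volume.restrict Ω), (∀ s i, |w x s i| ≤ K) ∧ IsUnit (w x) ∧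
      ∀ t m, |(w x)⁻¹ t m| ≤ K := by
    filter_upwards [h.gradient, ae_differentiableAt_of_lipschitzOnWith hΩ hlip,
      ae_restrict_mem hΩ.measurableSet] with x hx hd hxΩ
    rw [hx]
    exact ⟨abs_jac_le hΩ hlip hxΩ, isUnit_jac_and_abs_inv_le hΩ hanti hxΩ hd⟩
  exact ⟨fun s i => memLp_top_of_bound (hmeas s i).aestronglyMeasurable K
      (hae.mono fun x hx => hx.1 s i), hae.mono fun x hx => hx.2.1,
    fun t m => memLp_top_of_bound (aemeasurable_inv_entry hmeas t m).aestronglyMeasurable K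
      (hae.mono fun x hx => hx.2.2 t m), h.total⟩

/-- The weak counterpart of `pd_pull`. The bound on `w` is what the weak product rule for the
quadratic factor needs. -/
theorem hasWeakPartial_pull (hΩ : IsOpen Ω) (hG : IsSmoothMetricOn Ω G)
    {H : Fin n → Fin n → Fin n → Eu n → ℝ} {K : ℝ}
    (hw : ∀ s i j, HasWeakPartial Ω j (fun x => w x s i) (H s i j))
    (hb : ∀ s i, ∀ᵐ x ∂(volume.restrict Ω), |w x s i| ≤ K) (k i j : Fin n) :
    HasWeakPartial Ω k (fun x => ((w x)ᵀ * G x * w x) i j)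
      (fun x => dPull (G x) (w x) (pdMat G x) (fun s i k => H s i k x) k i j) := by
  have h1 := HasWeakPartial.sum Finset.univ fun s _ => HasWeakPartial.sum Finset.univ fun t _ =>
    ((hw s i k).mul hΩ (hw t j k) (hb s i) (hb t j)).mul_smooth hΩ (hG.smooth s t)
  refine h1.congr hΩ (Eventually.of_forall fun x => ?_) (Eventually.of_forall fun x => ?_)
  · simp only [pull_apply]
    exact Finset.sum_congr rfl fun s _ => Finset.sum_congr rfl fun t _ => by ring
  · simp only [dPull, ← Finset.sum_add_distrib, pdMat, Matrix.of_apply]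
    exact Finset.sum_congr rfl fun s _ => Finset.sum_congr rfl fun t _ => by ring

/-- The gradient of a solution of the design problem solves the full system. -/
theorem IsDesignSolution.isSystemSolution (hΩ : IsOpen Ω) (hG : IsSmoothMetricOn Ω G)
    (hGt : IsSmoothMetricOn Ω Gt) (h : IsDesignSolution Ω G Gt ξ) :
    IsSystemSolution Ω G Gt ξ (jac ξ) := by
  obtain ⟨-, K, hlip, hanti⟩ := h.bilipschitz
  have hjac := hasWeakPartial_jac hΩ hlip
  have hsob : ∀ s i, MemSobolevTwo Ω 1 (fun x => jac ξ x s i) := fun s i => by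
    obtain ⟨p, hp, hp1⟩ := (h.sobolev s).2 i
    exact hp1.congr hΩ (hp.unique hΩ (hjac s i))
  choose H hH _ using fun s i => (hsob s i).2
  have hbound : ∀ s i, ∀ᵐ x ∂(volume.restrict Ω), |jac ξ x s i| ≤ K := fun s i =>
    (ae_restrict_mem hΩ.measurableSet).mono fun x hx => abs_jac_le hΩ hlip hx s i
  refine ⟨h.bilipschitz, hsob, h.eqn, ae_eq_refl _, fun s i j => ?_⟩
  refine (hH s i j).congr hΩ (ae_eq_refl _) ?_
  have hsymm : ∀ᵐ x ∂(volume.restrict Ω), ∀ s i j, H s i j x = H s j i x :=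
    ae_all_iff.2 fun s => ae_all_iff.2 fun i => ae_all_iff.2 fun j =>
      (hjac s i).comm hΩ (hjac s j) (hH s i j) (hH s j i)
  -- The constraint gives `G̃` two weak gradients, the classical one and the product-rule
  -- expression, and weak gradients are unique.
  have hdt : ∀ᵐ x ∂(volume.restrict Ω), ∀ k i j, pdMat Gt x k i j
      = dPull (G x) (jac ξ x) (pdMat G x) (fun s i k => H s i k x) k i j :=
    ae_all_iff.2 fun k => ae_all_iff.2 fun i => ae_all_iff.2 fun j => by
      have h1 := hasWeakPartial_pull hΩ hG hH hbound k i j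
      have h2 : HasWeakPartial Ω k (fun x => Gt x i j) (pd k fun x => Gt x i j) :=
        hasWeakPartial_of_contDiffOn hΩ (hGt.smooth i j)
      exact (h2.congr hΩ (h.eqn.mono fun x hx => by simp only [hx]) (ae_eq_refl _)).unique hΩ h1
  filter_upwards [hsymm, hdt, h.eqn, ae_differentiableAt_of_lipschitzOnWith hΩ hlip,
    ae_restrict_mem hΩ.measurableSet] with x h1 h2 h3 h4 hx
  rw [totalRHS_eq]
  exact eq_total_of_pull (hG.isUnit hx) (isUnit_jac_and_abs_inv_le hΩ hanti hx h4).1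
    (hG.isSymm hx) (pdMat_isSymm hΩ (fun _ hy => hG.isSymm hy) hx) h1 h3 h2 s i j

/-- On a bounded domain a Lipschitz function is bounded and the measure is finite. -/
theorem memLp_coord (hΩ : IsOpen Ω) (hb : Bornology.IsBounded Ω) {K : NNReal}
    (h : LipschitzOnWith K ξ Ω) (t : Fin n) :
    MemLp (fun x => ξ x t) 2 (volume.restrict Ω) := by
  obtain ⟨F, hF, hFf⟩ := (h.coord t).extend_real
  obtain ⟨C, hC⟩ := (hF.isBounded_image hb).exists_norm_le
  have : IsFiniteMeasure (volume.restrict Ω) := ⟨by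
    rw [Measure.restrict_apply_univ]
    exact hb.measure_lt_top⟩
  refine MemLp.of_bound
    ((h.coord t).continuousOn.aestronglyMeasurable hΩ.measurableSet) C ?_
  filter_upwards [ae_restrict_mem hΩ.measurableSet] with x hx
  exact (congrArg norm (hFf hx)).le.trans (hC _ ⟨x, hx, rfl⟩)

/-- A solution of the full system solves the design problem. -/
theorem IsSystemSolution.isDesignSolution (hΩ : IsOpen Ω) (hb : Bornology.IsBounded Ω)
    (h : IsSystemSolution Ω G Gt ξ w) : IsDesignSolution Ω G Gt ξ := by
  obtain ⟨-, K, hlip, -⟩ := h.bilipschitz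
  refine ⟨h.bilipschitz, fun t => ⟨memLp_coord hΩ hb hlip t, fun i =>
    ⟨fun x => w x t i, ?_, h.sobolev t i⟩⟩, ?_⟩
  · exact (hasWeakPartial_jac hΩ hlip t i).congr hΩ (ae_eq_refl _)
      (h.gradient.mono fun x hx => by simp only [hx])
  · filter_upwards [h.algebraic, h.gradient] with x h1 h2
    rw [h1, h2]

end InverseDesign

end

/-! ### Assembly of the theorem -/

open InverseDesign
theorem mainTheorem6 {n : ℕ} (Ω : Set (Eu n)) (hΩ_open : IsOpen Ω)
    (hΩ_bdd : Bornology.IsBounded Ω) (hΩ_sc : IsSimplyConnected Ω)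
    (G Gt : MatField n) (hG : IsSmoothMetricOn Ω G) (hGt : IsSmoothMetricOn Ω Gt) :
    -- Part (i): the equivalence, which moreover holds with the same map `ξ`.
    (((∃ ξ, IsDesignSolution Ω G Gt ξ) ↔ ∃ ξ w, IsSystemSolution Ω G Gt ξ w) ∧
      ∀ ξ, IsDesignSolution Ω G Gt ξ ↔ ∃ w, IsSystemSolution Ω G Gt ξ w) ∧
    -- Part (ii), from the full system to the total differential system.
    (∀ ξ w, IsSystemSolution Ω G Gt ξ w → IsBoundedTotalSolution Ω G Gt w) ∧
    -- Part (ii), from the total differential system to the full system.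
    (∀ w, IsBoundedTotalSolution Ω G Gt w →
      (∃ ξ, IsSmoothPotential Ω w ξ) ∧
      ∀ ξ, IsSmoothPotential Ω w ξ →
        -- Local invertibility.
        (∀ x ∈ Ω, ∃ V : Set (Eu n), IsOpen V ∧ x ∈ V ∧ V ⊆ Ω ∧ Set.InjOn ξ V) ∧
        -- Every local inverse is smooth, and the two metrics have the same Christoffel symbols.
        (∀ (V : Set (Eu n)) (ζ : Eu n → Eu n), IsOpen V → V ⊆ Ω → Set.LeftInvOn ζ ξ V →
          IsOpen (ξ '' V) ∧ ContDiffOn ℝ ∞ ζ (ξ '' V) ∧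
          ∀ y ∈ ξ '' V, ∀ i k l,
            christoffel (transported G ζ) i k l y = christoffel (pulledBack Gt ζ) i k l y) ∧
        -- The algebraic constraint propagates from one point.
        (Set.InjOn ξ Ω →
          (∃ x₀ ∈ Ω, Gt x₀ = (jac ξ x₀)ᵀ * G x₀ * jac ξ x₀) →
          ∀ x ∈ Ω, Gt x = (jac ξ x)ᵀ * G x * jac ξ x)) := by
  have hiff : ∀ ξ, IsDesignSolution Ω G Gt ξ ↔ ∃ w, IsSystemSolution Ω G Gt ξ w := fun ξ =>
    ⟨fun h => ⟨_, h.isSystemSolution hΩ_open hG hGt⟩,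
      fun ⟨_, h⟩ => h.isDesignSolution hΩ_open hΩ_bdd⟩
  refine ⟨⟨exists_congr hiff, hiff⟩, fun ξ w h => h.isBoundedTotalSolution hΩ_open,
    fun w hw => ?_⟩
  obtain ⟨v, hv, hvw⟩ := hw.exists_classical hΩ_open hG hGt
  refine ⟨?_, fun ξ hξ => ?_⟩
  · obtain ⟨ξ, hξ, hj⟩ := hv.exists_potential hΩ_open hΩ_sc hG hGt
    refine ⟨ξ, hξ, (ae_restrict_iff' hΩ_open.measurableSet).2 ?_⟩
    filter_upwards [hvw] with x hx hxΩ
    rw [hj x hxΩ, hx hxΩ]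
  -- An arbitrary potential has the continuous gradient `∇ξ = v` a.e., hence everywhere on `Ω`, so
  -- all remaining claims reduce to classical solutions.
  · have hcl := hξ.isClassicalSolution hΩ_open hv hvw
    refine ⟨fun x hx => exists_injOn_nhds hΩ_open hξ.1 hcl.isUnit hx, fun V ζ hV hVΩ hζ => ?_,
      fun _ ⟨x₀, hx₀, h0⟩ x hx => hcl.pull_eq hΩ_open
        hΩ_sc.isPathConnected.isConnected.isPreconnected hG hGt hx₀ h0 hx⟩
    obtain ⟨h1, h2⟩ := isOpen_image_and_contDiffOn hΩ_open hξ.1 hcl.isUnit hV hVΩ hζ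
    exact ⟨h1, h2, fun y hy i k l =>
      christoffel_transported_eq hΩ_open hG hGt hξ.1 hcl hV hVΩ hζ hy i k l⟩
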